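/- Theorem. For $n\in\mathbb N$ let $m=\binom n2$, let $e_{1},\dots,e_{m}$ be the edges of the complete graph on $[n]=\{1,\dots,n\}$, let $\pi$ be a uniformly random permutation of $\{1,\dots,m\}$, and let $\tilde G=(G_i)_{i=0}^{m}$ be the random graph process on $[n]$, i.e. $G_i=([n],\{e_{\pi(1)},\dots,e_{\pi(i)}\})$. For a monotone increasing graph property $\mathcal P$ let $\tau(\tilde G,\mathcal P)=\min\{i : G_i\in\mathcal P\}$ be its hitting time (with $\tau=\infty$ if there is no such $i$). In the $(1:1)$ vertex $K_3$-game on a graph $G$, two players, Maker and Breaker, alternately claim one free vertex of $G$ each until all vertices are claimed; Maker wins if the subgraph of $G$ induced by his vertices contains a triangle, and otherwise Breaker wins. Let $\mathcal M^1_{K_3}$ (respectively $\mathcal M^2_{K_3}$) be the property that Maker has a winning strategy in this game when he moves first (respectively second). Let the double diamond $DD$ be the graph on the seven vertices $x,y_1,z_1,z_2,y_2,z_3,z_4$ with the ten edges $xy_1,xz_1,xz_2,y_1z_1,y_1z_2,xy_2,xz_3,xz_4,y_2z_3,y_2z_4$ (two copies of $K_4$ minus an edge sharing exactly the vertex $x$).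 For $k\ge 1$ let $\mathcal G_{kDD}$ be the property of containing at least $k$ distinct, possibly intersecting, (not necessarily induced) subgraphs isomorphic to $DD$, and write $\mathcal G_{DD}=\mathcal G_{1DD}$. Then, with probability tending to $1$ as $n\to\infty$, $$\tau(\tilde G,\mathcal M^1_{K_3})=\tau(\tilde G,\mathcal G_{DD})\qquad\text{and}\qquad \tau(\tilde G,\mathcal M^2_{K_3})=\tau(\tilde G,\mathcal G_{2DD}).$$ -/

import Mathlib

open Filter Topology

/-! ### The unbiased Maker-Breaker vertex game -/

/-- The two players of a Maker-Breaker game. -/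
inductive Player
  | maker
  | breaker

/-- `MakerWinsFrom Wins turn M B`: in the `(1:1)` Maker-Breaker game on the finite board `V`,
Maker has a winning strategy from the position in which Maker has claimed exactly the elements
of `M`, Breaker has claimed exactly the elements of `B`, and it is the turn of `turn` to claim a
free element. The game ends when all elements are claimed, and Maker has won if his elements
form a set satisfying `Wins`; otherwise Breaker has won.

A derivation is precisely a (finite) strategy tree for Maker: one chosen move at each position
where Maker is to move, and a continuation for every possible reply of Breaker. -/
inductive MakerWinsFrom {V : Type} [DecidableEq V] (Wins : Finset V → Prop) :
    Player → Finset V → Finset V → Prop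
  | gameOver (turn : Player) (M B : Finset V)
      (hfull : ∀ v, v ∈ M ∪ B) (hwin : Wins M) :
      MakerWinsFrom Wins turn M B
  | makerMove (M B : Finset V) (v : V) (hfree : v ∉ M ∪ B)
      (hnext : MakerWinsFrom Wins .breaker (insert v M) B) :
      MakerWinsFrom Wins .maker M B
  | breakerMove (M B : Finset V) (hexists : ∃ v, v ∉ M ∪ B)
      (hnext : ∀ v, v ∉ M ∪ B → MakerWinsFrom Wins .maker M (insert v B)) :
      MakerWinsFrom Wins .breaker M B

/-- `G` is Maker's win in the `(1:1)` vertex `H`-game, where `first` makes the first move: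
Maker wins if the subgraph of `G` induced by his vertices contains a copy of `H`. -/
def IsMakerWin {V W : Type} [DecidableEq V] (H : SimpleGraph W) (first : Player)
    (G : SimpleGraph V) : Prop :=
  MakerWinsFrom (fun M : Finset V => H.IsContained (G.induce (M : Set V))) first ∅ ∅

/-- The triangle `K₃`. -/
abbrev triangleGraph : SimpleGraph (Fin 3) := ⊤

/-! ### The double diamond -/

/-- The double diamond `DD`, with the labelling
`x = 0`, `y₁ = 1`, `z₁ = 2`, `z₂ = 3`, `y₂ = 4`, `z₃ = 5`, `z₄ = 6`:
the diamonds on `{x, y₁, z₁, z₂}` and `{x, y₂, z₃, z₄}` (missing edges `z₁z₂` and `z₃z₄`), which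
share exactly the center `x`. -/
def doubleDiamond : SimpleGraph (Fin 7) :=
  SimpleGraph.fromEdgeSet
    {s(0, 1), s(0, 2), s(0, 3), s(1, 2), s(1, 3),
     s(0, 4), s(0, 5), s(0, 6), s(4, 5), s(4, 6)}

/-- The property of containing at least `k` (distinct, possibly intersecting) copies of `H`,
a copy being a (not necessarily induced) subgraph isomorphic to `H`. -/
def ContainsCopies {V W : Type} [Fintype V] (k : ℕ) (H : SimpleGraph W)
    (G : SimpleGraph V) : Prop :=
  k ≤ G.copyCount H

/-! ### The random graph process -/

/-- An ordering of all the edges of the complete graph on `n` vertices. -/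
abbrev EdgeOrdering (n : ℕ) : Type :=
  Fin (n.choose 2) ≃ (⊤ : SimpleGraph (Fin n)).edgeSet

instance (n : ℕ) : Nonempty (EdgeOrdering n) := by
  classical
  refine ⟨(Fintype.equivFinOfCardEq ?_).symm⟩
  rw [← SimpleGraph.edgeFinset_card]
  simpa using SimpleGraph.card_edgeFinset_top_eq_card_choose_two (V := Fin n)

/-- The graph `G_i` of the graph process of an edge ordering: its edges are the first `i` edges
of the ordering (all edges, if `i ≥ n.choose 2`). -/
def graphProcess {n : ℕ} (π : EdgeOrdering n) (i : ℕ) : SimpleGraph (Fin n) :=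
  SimpleGraph.fromEdgeSet {e | ∃ j : Fin (n.choose 2), (j : ℕ) < i ∧ (π j : Sym2 (Fin n)) = e}

/-- The hitting time of the property `P` in the graph process of `π`, i.e. the least `i` such
that `G_i` satisfies `P` (and `⊤` if there is none). -/
noncomputable def hittingTime {n : ℕ} (π : EdgeOrdering n)
    (P : SimpleGraph (Fin n) → Prop) : ℕ∞ :=
  ⨅ (i : ℕ) (_ : P (graphProcess π i)), (i : ℕ∞)

/-- The probability of the event `A` in the random graph process on `n` vertices, that is, when
the edge ordering is chosen uniformly at random. -/
noncomputable def processProb (n : ℕ) (A : Set (EdgeOrdering n)) : ENNReal :=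
  open Classical in (PMF.uniformOfFintype (EdgeOrdering n)).toOuterMeasure A

/-- A sequence of events in the random graph processes holds with high probability if its
probability tends to `1` as the number of vertices tends to infinity. -/
def ProcessWhp (A : ∀ n : ℕ, Set (EdgeOrdering n)) : Prop :=
  Tendsto (fun n => processProb n (A n)) atTop (𝓝 1)

/-!
The proof compares the two games with double diamonds on every graph `G` that is *sparse*: each set
`S` of at most `30` vertices satisfies `7 e(S) ≤ 10 |S|`. After `stepCount n` steps the edge density
is about `n ^ (-699/1000)`, slightly above the threshold `n ^ (-7/10)` of the double diamond, which
has `7` vertices and `10` edges. With high probability `G` is then still sparse, by a first moment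
bound (`sparse_whp`), but it already contains two double diamonds, by the second moment method
(`containsCopies_whp`), applied to copies that have their `i`-th vertex in the `i`-th of seven
intervals. Since sparsity passes to subgraphs, all earlier graphs of the process are sparse as well,
and it remains to determine the winner on sparse graphs (`isMakerWin_maker_iff`,
`isMakerWin_breaker_iff`).

Maker, moving first, wins on a double diamond: he takes the centre, then the other hub of a diamond
that Breaker has not touched, and then one of its two tips. In a sparse graph distinct double
diamonds are disjoint, as the double diamond is strictly balanced (`Sparse.disjoint_copies`); so if
there are two of them, Breaker's first move leaves one intact.

For Breaker, the point is that the triangles of a sparse graph without double diamonds can be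
*paired*: there are disjoint pairs of vertices such that each triangle contains a pair
(`pairable_of_sparse`), and Breaker wins by always taking the partner of Maker's last vertex
(`not_makerWinsFrom_of_pairing`). If there is just one double diamond and Breaker moves first, he
first takes one of its vertices. To find a pairing, consider a minimal vertex set `W` without one.
Starting from a diamond in `W`, or else from a triangle, the set `S` explored so far can be enlarged
by a triangle that meets it, since otherwise pairings of `S` and of its complement could be
combined. Each such step lowers the excess `10 |S| - 7 e(S)`: by `1` if the triangle meets `S` in
one vertex, by `4` if it meets `S` in an edge, and by `7` more for every additional edge. A triangle
has excess `9` and a diamond has excess `5`, so the excess becomes negative after few steps, and the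
short list of possible structures can be paired explicitly.
-/

/-! ### Pairings of triangles -/

section Pairing

variable {V : Type*}

/-- `σ` is a partial pairing of the elements of `W`: an involution which moves only elements
of `W`. The pairs are the sets `{x, σ x}` with `σ x ≠ x`. -/
structure PairingOn (σ : V → V) (W : Finset V) : Prop where
  invol : ∀ x, σ (σ x) = x
  fixed : ∀ x, x ∉ W → σ x = x

/-- The set `T` contains one of the pairs of `σ`. -/
def ContainsPair (σ : V → V) (T : Finset V) : Prop :=
  ∃ x ∈ T, σ x ∈ T ∧ σ x ≠ x

/-- There is a pairing of elements of `W` such that each triangle of `G` inside `W` contains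
a pair. -/
def Pairable (G : SimpleGraph V) (W : Finset V) : Prop :=
  ∃ σ, PairingOn σ W ∧ ∀ T ⊆ W, G.IsNClique 3 T → ContainsPair σ T

lemma PairingOn.mem {σ : V → V} {W : Finset V} (h : PairingOn σ W) {x : V} (hx : x ∈ W) :
    σ x ∈ W := by
  by_contra hn
  have := h.fixed _ hn
  rw [h.invol] at this
  exact hn (this ▸ hx)

lemma PairingOn.mono {σ : V → V} {W W' : Finset V} (h : PairingOn σ W) (hW : W ⊆ W') :
    PairingOn σ W' :=
  ⟨h.invol, fun x hx => h.fixed x fun hx' => hx (hW hx')⟩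

variable [DecidableEq V]

lemma PairingOn.union {σ τ : V → V} {A B : Finset V} (hσ : PairingOn σ A) (hτ : PairingOn τ B)
    (hAB : Disjoint A B) :
    ∃ ρ, PairingOn ρ (A ∪ B) ∧ ∀ T, ContainsPair σ T ∨ ContainsPair τ T → ContainsPair ρ T := by
  have hB : ∀ x ∈ B, x ∉ A := fun x hx hx' => Finset.disjoint_left.1 hAB hx' hx
  refine ⟨fun x => if x ∈ A then σ x else τ x, ⟨fun x => ?_, fun x hx => ?_⟩, ?_⟩
  · by_cases hx : x ∈ A
    · simp [hx, hσ.mem hx, hσ.invol]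
    · have : τ x ∉ A := by
        by_cases hxB : x ∈ B
        · exact hB _ (hτ.mem hxB)
        · rwa [hτ.fixed x hxB]
      simp [hx, this, hτ.invol]
  · rw [Finset.mem_union, not_or] at hx
    simp [hx.1, hτ.fixed x hx.2]
  · rintro T (⟨x, hx, hx1, hx2⟩ | ⟨x, hx, hx1, hx2⟩)
    · have : x ∈ A := by
        by_contra h
        exact hx2 (hσ.fixed x h)
      exact ⟨x, hx, by simp [this, hx1], by simp [this, hx2]⟩
    · have : x ∉ A := hB x (by
        by_contra h
        exact hx2 (hτ.fixed x h))
      exact ⟨x, hx, by simp [this, hx1], by simp [this, hx2]⟩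

lemma pairingOn_swap (a b : V) : PairingOn (Equiv.swap a b) {a, b} := by
  refine ⟨fun x => Equiv.swap_apply_self a b x, fun x hx => ?_⟩
  simp only [Finset.mem_insert, Finset.mem_singleton, not_or] at hx
  exact Equiv.swap_apply_of_ne_of_ne hx.1 hx.2

lemma containsPair_swap {a b : V} (hab : a ≠ b) {T : Finset V} (ha : a ∈ T) (hb : b ∈ T) :
    ContainsPair (Equiv.swap a b) T :=
  ⟨a, ha, by simpa using hb, by simpa using hab.symm⟩

variable {G : SimpleGraph V}

lemma Pairable.union {A B : Finset V} (hA : Pairable G A) (hB : Pairable G B)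
    (hAB : Disjoint A B)
    (h : ∀ T ⊆ A ∪ B, G.IsNClique 3 T → T ⊆ A ∨ T ⊆ B) : Pairable G (A ∪ B) := by
  obtain ⟨σ, hσ, hσ'⟩ := hA
  obtain ⟨τ, hτ, hτ'⟩ := hB
  obtain ⟨ρ, hρ, hρ'⟩ := hσ.union hτ hAB
  exact ⟨ρ, hρ, fun T hT hc => hρ' T <| (h T hT hc).imp (hσ' T · hc) (hτ' T · hc)⟩

/-- A pairing can be extended by two new vertices `u` and `w` if every new triangle contains
both of them. -/
lemma Pairable.insert_pair {S : Finset V} (hS : Pairable G S) {u w : V} (huw : u ≠ w)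
    (hu : u ∉ S) (hw : w ∉ S)
    (h : ∀ T ⊆ insert w (insert u S), G.IsNClique 3 T → ¬ T ⊆ S → u ∈ T ∧ w ∈ T) :
    Pairable G (insert w (insert u S)) := by
  obtain ⟨σ, hσ, hσ'⟩ := hS
  obtain ⟨ρ, hρ, hρ'⟩ := hσ.union (pairingOn_swap u w) (by simp [hu, hw])
  refine ⟨ρ, hρ.mono (by grind), fun T hT hc => hρ' T ?_⟩
  by_cases hTS : T ⊆ S
  · exact .inl (hσ' T hTS hc)
  · exact .inr (containsPair_swap huw (h T hT hc hTS).1 (h T hT hc hTS).2)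

lemma pairable_of_one_pair {W : Finset V} {a b : V} (hab : a ≠ b) (ha : a ∈ W) (hb : b ∈ W)
    (h : ∀ T ⊆ W, G.IsNClique 3 T → a ∈ T ∧ b ∈ T) : Pairable G W :=
  ⟨_, (pairingOn_swap a b).mono (by grind), fun T hT hc =>
    containsPair_swap hab (h T hT hc).1 (h T hT hc).2⟩

lemma pairable_of_two_pairs {W : Finset V} {a b c d : V} (hab : a ≠ b) (hcd : c ≠ d)
    (hac : a ≠ c) (had : a ≠ d) (hbc : b ≠ c) (hbd : b ≠ d)
    (hW : {a, b, c, d} ⊆ W)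
    (h : ∀ T ⊆ W, G.IsNClique 3 T → (a ∈ T ∧ b ∈ T) ∨ (c ∈ T ∧ d ∈ T)) : Pairable G W := by
  obtain ⟨ρ, hρ, hρ'⟩ := (pairingOn_swap a b).union (pairingOn_swap c d)
    (by simp [hac.symm, had.symm, hbc.symm, hbd.symm])
  exact ⟨ρ, hρ.mono (by grind), fun T hT hc => hρ' T <| (h T hT hc).imp
    (fun h => containsPair_swap hab h.1 h.2) (fun h => containsPair_swap hcd h.1 h.2)⟩

lemma exists_eq_triple_of_mem {T : Finset V} (hT : G.IsNClique 3 T) {v : V} (hv : v ∈ T) :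
    ∃ x y, G.Adj v x ∧ G.Adj v y ∧ G.Adj x y ∧ T = {v, x, y} := by
  obtain ⟨a, b, c, hab, hac, hbc, rfl⟩ := SimpleGraph.is3Clique_iff.1 hT
  simp only [Finset.mem_insert, Finset.mem_singleton] at hv
  rcases hv with rfl | rfl | rfl
  · exact ⟨_, _, hab, hac, hbc, rfl⟩
  · exact ⟨_, _, hab.symm, hbc, hac, by grind⟩
  · exact ⟨_, _, hac.symm, hbc.symm, hab, by grind⟩

end Pairing

/-! ### Sparse graphs -/

section Sparse

variable {V : Type*} (G : SimpleGraph V)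

open scoped Classical in
/-- The edges of `G` inside the vertex set `S`. -/
noncomputable def edgesIn (S : Finset V) : Finset (Sym2 V) :=
  S.sym2.filter (· ∈ G.edgeSet)

/-- The excess `10 |S| - 7 e(S)` of a vertex set `S`. The double diamond has excess `0`, and so
sets of negative excess are too dense to occur in the random graph when it first contains a double
diamond. -/
noncomputable def excess (S : Finset V) : ℤ :=
  10 * S.card - 7 * (edgesIn G S).card

/-- All sets of at most `30` vertices have nonnegative excess. The bound `30` leaves room for all
sets that occur in the exploration of the triangles of a graph. -/
def Sparse : Prop :=
  ∀ S : Finset V, S.card ≤ 30 → 0 ≤ excess G S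

variable {G}

lemma Sparse.anti {G' : SimpleGraph V} (h : Sparse G) (hG : G' ≤ G) : Sparse G' := by
  intro S hS
  have h1 := h S hS
  have h2 : (edgesIn G' S).card ≤ (edgesIn G S).card :=
    Finset.card_le_card <| by
      classical
      exact Finset.monotone_filter_right _ fun e _ he => SimpleGraph.edgeSet_mono hG he
  unfold excess at *
  omega

lemma excess_singleton (v : V) : excess G {v} = 10 := by
  simp [excess, edgesIn, Finset.filter_singleton]

variable [DecidableEq V]

/-- A new vertex with the neighbours `N` in `S` changes the excess by at most `10 - 7 |N|`. -/
lemma excess_insert_le {S N : Finset V} {v : V} (hv : v ∉ S) (hN : N ⊆ S)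
    (hadj : ∀ x ∈ N, G.Adj v x) :
    excess G (insert v S) ≤ excess G S + 10 - 7 * N.card := by
  classical
  have hinj : Set.InjOn (fun x => s(v, x)) (N : Set V) := by
    intro x hx y hy hxy
    exact Sym2.congr_right.1 hxy
  have hdis : Disjoint (edgesIn G S) (N.image fun x => s(v, x)) := by
    rw [Finset.disjoint_left]
    intro e he he'
    obtain ⟨x, hx, rfl⟩ := Finset.mem_image.1 he'
    simp [edgesIn, hv] at he
  have hsub : edgesIn G S ∪ N.image (fun x => s(v, x)) ⊆ edgesIn G (insert v S) := by
    apply Finset.union_subset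
    · exact Finset.filter_subset_filter _ (Finset.sym2_mono (Finset.subset_insert _ _))
    · intro e he
      obtain ⟨x, hx, rfl⟩ := Finset.mem_image.1 he
      simp [edgesIn, hN hx, hadj x hx]
  have h1 := Finset.card_le_card hsub
  rw [Finset.card_union_of_disjoint hdis, Finset.card_image_of_injOn hinj] at h1
  have h2 := Finset.card_insert_of_notMem hv
  unfold excess
  omega

lemma excess_insert_one {S : Finset V} {v x : V} (hv : v ∉ S) (hx : x ∈ S) (h : G.Adj v x) :
    excess G (insert v S) ≤ excess G S + 3 := by
  have := excess_insert_le (G := G) (N := {x}) hv (by simpa) (by simpa)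
  simp at this
  omega

lemma excess_insert_two {S : Finset V} {v x y : V} (hv : v ∉ S) (hx : x ∈ S) (hy : y ∈ S)
    (hxy : x ≠ y) (h : G.Adj v x) (h' : G.Adj v y) :
    excess G (insert v S) ≤ excess G S - 4 := by
  have := excess_insert_le (G := G) (N := {x, y}) hv (by grind) (by grind)
  rw [Finset.card_pair hxy] at this
  omega

lemma excess_insert_three {S : Finset V} {v x y z : V} (hv : v ∉ S) (hx : x ∈ S) (hy : y ∈ S)
    (hz : z ∈ S) (hxy : x ≠ y) (hxz : x ≠ z) (hyz : y ≠ z) (h : G.Adj v x) (h' : G.Adj v y)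
    (h'' : G.Adj v z) :
    excess G (insert v S) ≤ excess G S - 11 := by
  have := excess_insert_le (G := G) (N := {x, y, z}) hv (by grind) (by grind)
  rw [Finset.card_eq_three.2 ⟨x, y, z, hxy, hxz, hyz, rfl⟩] at this
  omega

/-- Attaching a triangle `s u w` to `S` at the vertex `s` lowers the excess. -/
lemma excess_attach {S : Finset V} {s u w : V} (hs : s ∈ S) (hu : u ∉ S) (hw : w ∉ S)
    (hsu : G.Adj s u) (hsw : G.Adj s w) (huw : G.Adj u w) :
    excess G (insert w (insert u S)) ≤ excess G S - 1 := by
  have h1 := excess_insert_one hu hs hsu.symm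
  have h2 := excess_insert_two (G := G) (S := insert u S) (v := w) (x := s) (y := u)
    (by grind [huw.ne]) (by grind) (by grind) hsu.ne hsw.symm huw.symm
  omega

/-- Attaching a triangle `s u w` to `S` at the vertex `s` lowers the excess by at least `8` if
there is a further edge between `S` and `{u, w}`. -/
lemma excess_attach_extra {S : Finset V} {s s' u w : V} (hs : s ∈ S) (hu : u ∉ S) (hw : w ∉ S)
    (hsu : G.Adj s u) (hsw : G.Adj s w) (huw : G.Adj u w) (hs' : s' ∈ S) (hne : s' ≠ s)
    (h : G.Adj u s' ∨ G.Adj w s') :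
    excess G (insert w (insert u S)) ≤ excess G S - 8 := by
  rcases h with h | h
  · have h1 := excess_insert_two hu hs hs' hne.symm hsu.symm h
    have h2 := excess_insert_two (G := G) (S := insert u S) (v := w) (x := s) (y := u)
      (by grind [huw.ne]) (by grind) (by grind) hsu.ne hsw.symm huw.symm
    omega
  · have h1 := excess_insert_one hu hs hsu.symm
    have h2 := excess_insert_three (G := G) (S := insert u S) (v := w) (x := s) (y := u) (z := s')
      (by grind [huw.ne]) (by grind) (by grind) (by grind) hsu.ne hne.symm
      (by rintro rfl; exact hu hs') hsw.symm huw.symm h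
    omega

end Sparse

/-! ### Pairing the triangles of a sparse graph without double diamonds -/

section Structure

variable {V : Type*} {G : SimpleGraph V}

/-- The four vertices `a`, `b`, `c`, `d` span a diamond with hubs `a`, `b` and tips `c`, `d`. -/
structure IsDiamond (G : SimpleGraph V) (a b c d : V) : Prop where
  hubs : G.Adj a b
  ac : G.Adj a c
  bc : G.Adj b c
  ad : G.Adj a d
  bd : G.Adj b d
  tips : c ≠ d

lemma IsDiamond.swap_hubs {a b c d : V} (h : IsDiamond G a b c d) : IsDiamond G b a c d :=
  ⟨h.hubs.symm, h.bc, h.ac, h.bd, h.ad, h.tips⟩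

/-- `W` is a minimal set of vertices whose triangles cannot be paired. -/
structure MinimalUnpairable (G : SimpleGraph V) (W : Finset V) : Prop where
  not_pairable : ¬ Pairable G W
  pairable_of_ssubset : ∀ W' ⊂ W, Pairable G W'

lemma exists_minimalUnpairable {W : Finset V} (h : ¬ Pairable G W) :
    ∃ W', MinimalUnpairable G W' := by
  induction W using Finset.strongInduction with
  | H W ih =>
    by_cases h' : ∃ W' ⊂ W, ¬ Pairable G W'
    · obtain ⟨W', hW', hn⟩ := h'
      exact ih W' hW' hn
    · push Not at h'
      exact ⟨W, h, h'⟩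

variable [DecidableEq V]

/-- If `S` can be paired then some triangle in `W` meets `S` in one or two vertices; otherwise
pairings of `S` and of `W \ S` would combine to a pairing of `W`. -/
lemma MinimalUnpairable.exists_attached {W S : Finset V} (hW : MinimalUnpairable G W)
    (hSW : S ⊆ W) (hne : S.Nonempty) (hS : Pairable G S) :
    (∃ s ∈ S, ∃ t ∈ S, ∃ v ∈ W, v ∉ S ∧ G.Adj s t ∧ G.Adj v s ∧ G.Adj v t) ∨
    (∃ s ∈ S, ∃ u ∈ W, ∃ w ∈ W, u ∉ S ∧ w ∉ S ∧ G.Adj s u ∧ G.Adj s w ∧ G.Adj u w) := by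
  by_contra hcon
  rw [not_or] at hcon
  obtain ⟨h1, h2⟩ := hcon
  have hsd : W \ S ⊂ W := by
    refine Finset.sdiff_ssubset hSW hne
  have key := hS.union (hW.pairable_of_ssubset _ hsd) Finset.disjoint_sdiff
  rw [Finset.union_sdiff_of_subset hSW] at key
  refine hW.not_pairable (key fun T hT hc => ?_)
  by_contra hT2
  rw [not_or] at hT2
  obtain ⟨⟨y, hy, hyS⟩, hT3⟩ :=
    And.imp_left (fun h => Finset.not_subset.1 h) hT2
  obtain ⟨x, hx, hxS⟩ : ∃ x ∈ T, x ∈ S := by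
    obtain ⟨x, hx, hx'⟩ := Finset.not_subset.1 hT3
    exact ⟨x, hx, by simpa [hT hx] using hx'⟩
  obtain ⟨a, b, hya, hyb, hab, rfl⟩ := exists_eq_triple_of_mem hc hy
  have haW : a ∈ W := hT (by simp)
  have hbW : b ∈ W := hT (by simp)
  have hyW : y ∈ W := hT (by simp)
  by_cases haS : a ∈ S
  · by_cases hbS : b ∈ S
    · exact h1 ⟨a, haS, b, hbS, y, hyW, hyS, hab, hya, hyb⟩
    · exact h2 ⟨a, haS, y, hyW, b, hbW, hyS, hbS, hya.symm, hab, hyb⟩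
  · have hbS : b ∈ S := by grind
    exact h2 ⟨b, hbS, y, hyW, a, haW, hyS, haS, hyb.symm, hab.symm, hya⟩

lemma card_insert_insert_le (S : Finset V) (u w : V) :
    (insert w (insert u S)).card ≤ S.card + 2 :=
  (Finset.card_insert_le _ _).trans (Nat.succ_le_succ (Finset.card_insert_le _ _))

/-- If neither of two new adjacent vertices `u` and `w` forms a triangle with an edge inside `S`,
then all new triangles contain the pair `{u, w}`. -/
lemma Pairable.attach {S : Finset V} (hS : Pairable G S) {u w : V}
    (hu : u ∉ S) (hw : w ∉ S) (huw : G.Adj u w)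
    (h : ∀ x ∈ S, ∀ y ∈ S, G.Adj x y → ¬ (G.Adj u x ∧ G.Adj u y) ∧ ¬ (G.Adj w x ∧ G.Adj w y)) :
    Pairable G (insert w (insert u S)) := by
  refine hS.insert_pair huw.ne hu hw fun T hT hc hTS => ?_
  obtain ⟨v, hv, hvS⟩ := Finset.not_subset.1 hTS
  obtain ⟨x, y, hvx, hvy, hxy, rfl⟩ := exists_eq_triple_of_mem hc hv
  have hxT : x ∈ insert w (insert u S) := hT (by simp)
  have hyT : y ∈ insert w (insert u S) := hT (by simp)
  have hvT : v ∈ insert w (insert u S) := hT (by simp)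
  have := h x
  have := hvx.ne
  have := hvy.ne
  grind

/-- If `S` has small excess, further edges between `S` and an attached triangle would make the
resulting set too dense. -/
lemma Pairable.attach_of_excess (hG : Sparse G) {S : Finset V} (hS : Pairable G S) {s u w : V}
    (hs : s ∈ S) (hu : u ∉ S) (hw : w ∉ S)
    (hsu : G.Adj s u) (hsw : G.Adj s w) (huw : G.Adj u w)
    (hcard : S.card ≤ 28) (hex : excess G S ≤ 7) :
    Pairable G (insert w (insert u S)) := by
  refine hS.attach hu hw huw fun x hx y hy hxy => ?_
  by_contra hcon
  have : ∃ s' ∈ S, s' ≠ s ∧ (G.Adj u s' ∨ G.Adj w s') := by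
    by_cases hxs : x = s
    · exact ⟨y, hy, by rintro rfl; exact hxy.ne hxs, by tauto⟩
    · exact ⟨x, hx, hxs, by tauto⟩
  obtain ⟨s', hs', hne, h⟩ := this
  have h1 := excess_attach_extra hs hu hw hsu hsw huw hs' hne h
  have h2 := hG _ ((card_insert_insert_le S u w).trans (by omega))
  omega

/-- A set of excess at most `3` can only grow by attaching triangles at single vertices. Each
such step preserves pairability and lowers the excess, which thus becomes negative. A step adds two
vertices and lowers `k` by one, so the hypothesis on `|S| + 2 k` keeps all sets small enough for
sparseness to apply. -/
lemma MinimalUnpairable.false_of_excess_le_three (hG : Sparse G) {W : Finset V}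
    (hW : MinimalUnpairable G W) (k : ℕ) (hk : k ≤ 3) {S : Finset V} (hSW : S ⊆ W)
    (hne : S.Nonempty) (hS : Pairable G S) (hcard : S.card + 2 * k ≤ 28)
    (hex : excess G S ≤ k) : False := by
  induction k generalizing S with
  | zero =>
    rcases hW.exists_attached hSW hne hS with
      ⟨s, hs, t, ht, v, hv, hvS, hst, hvs, hvt⟩ | ⟨s, hs, u, hu, w, hw, huS, hwS, hsu, hsw, huw⟩
    · have h1 := excess_insert_two hvS hs ht hst.ne hvs hvt
      have h2 := hG (insert v S) ((Finset.card_insert_le _ _).trans (by omega))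
      push_cast at *
      omega
    · have h1 := excess_attach hs huS hwS hsu hsw huw
      have h2 := hG _ ((card_insert_insert_le S u w).trans (by omega))
      push_cast at *
      omega
  | succ k ih =>
    rcases hW.exists_attached hSW hne hS with
      ⟨s, hs, t, ht, v, hv, hvS, hst, hvs, hvt⟩ | ⟨s, hs, u, hu, w, hw, huS, hwS, hsu, hsw, huw⟩
    · have h1 := excess_insert_two hvS hs ht hst.ne hvs hvt
      have h2 := hG (insert v S) ((Finset.card_insert_le _ _).trans (by omega))
      push_cast at *
      omega
    · have h1 := excess_attach hs huS hwS hsu hsw huw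
      have h2 := card_insert_insert_le S u w
      refine ih (by omega) (S := insert w (insert u S)) (by grind) (by simp)
        (hS.attach_of_excess hG hs huS hwS hsu hsw huw (by omega) ?_) (by omega) ?_
      all_goals push_cast at *; omega

lemma IsDiamond.excess_le {a b c d : V} (h : IsDiamond G a b c d) :
    excess G {d, c, b, a} ≤ 5 := by
  have h0 := excess_singleton (G := G) a
  have h1 := excess_insert_one (G := G) (S := {a}) (v := b) (x := a)
    (by simp [h.hubs.ne']) (by simp) h.hubs.symm
  have h2 := excess_insert_two (G := G) (S := {b, a}) (v := c) (x := b) (y := a)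
    (by simp [h.bc.ne', h.ac.ne']) (by simp) (by simp) h.hubs.ne' h.bc.symm h.ac.symm
  have h3 := excess_insert_two (G := G) (S := {c, b, a}) (v := d) (x := b) (y := a)
    (by simp [h.bd.ne', h.ad.ne', h.tips.symm]) (by simp) (by simp) h.hubs.ne' h.bd.symm h.ad.symm
  omega

/-- The tips of a diamond are not adjacent, as `K₄` is too dense. -/
lemma IsDiamond.not_adj {a b c d : V} (hG : Sparse G) (h : IsDiamond G a b c d) :
    ¬ G.Adj c d := by
  intro hcd
  have h0 := excess_singleton (G := G) a
  have h1 := excess_insert_one (G := G) (S := {a}) (v := b) (x := a)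
    (by simp [h.hubs.ne']) (by simp) h.hubs.symm
  have h2 := excess_insert_two (G := G) (S := {b, a}) (v := c) (x := b) (y := a)
    (by simp [h.bc.ne', h.ac.ne']) (by simp) (by simp) h.hubs.ne' h.bc.symm h.ac.symm
  have h3 := excess_insert_three (G := G) (S := {c, b, a}) (v := d) (x := b) (y := a) (z := c)
    (by simp [h.bd.ne', h.ad.ne', h.tips.symm]) (by simp) (by simp) (by simp)
    h.hubs.ne' h.bc.ne h.ac.ne h.bd.symm h.ad.symm hcd.symm
  have h4 := hG {d, c, b, a} (Finset.card_le_four.trans (by norm_num))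
  omega

lemma IsDiamond.mem_of_clique (hG : Sparse G) {a b c d : V} (h : IsDiamond G a b c d)
    {T : Finset V} (hT : T ⊆ {d, c, b, a}) (hc : G.IsNClique 3 T) : a ∈ T ∧ b ∈ T := by
  have hcd := h.not_adj hG
  obtain ⟨x, y, z, hxy, hxz, hyz, rfl⟩ := SimpleGraph.is3Clique_iff.1 hc
  have hx : x ∈ ({d, c, b, a} : Finset V) := hT (by simp)
  have hy : y ∈ ({d, c, b, a} : Finset V) := hT (by simp)
  have hz : z ∈ ({d, c, b, a} : Finset V) := hT (by simp)
  have := hxy.ne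
  have := hxz.ne
  have := hyz.ne
  have hdc : ¬ G.Adj d c := fun h => hcd h.symm
  grind

lemma IsDiamond.pairable (hG : Sparse G) {a b c d : V} (h : IsDiamond G a b c d) :
    Pairable G {d, c, b, a} :=
  pairable_of_one_pair h.hubs.ne (by simp) (by simp) fun _ hT hc => h.mem_of_clique hG hT hc

/-- A vertex outside a set of small excess has at most two neighbours in this set. -/
lemma eq_or_eq_of_adj (hG : Sparse G) {S : Finset V} {v p q x : V} (hv : v ∉ S) (hp : p ∈ S)
    (hq : q ∈ S) (hpq : p ≠ q) (hvp : G.Adj v p) (hvq : G.Adj v q) (hcard : S.card ≤ 29)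
    (hex : excess G S ≤ 10) (hx : x ∈ S) (hvx : G.Adj v x) : x = p ∨ x = q := by
  by_contra hcon
  rw [not_or] at hcon
  have h1 := excess_insert_three hv hp hq hx hpq (Ne.symm hcon.1) (Ne.symm hcon.2) hvp hvq hvx
  have h2 := hG (insert v S) ((Finset.card_insert_le _ _).trans (by omega))
  omega

/-- The triangles in a diamond with a vertex added over one of its edges can be paired. -/
lemma IsDiamond.pairable_insert (hG : Sparse G) {a b c d v p q : V} (h : IsDiamond G a b c d)
    (hv : v ∉ ({d, c, b, a} : Finset V)) (hp : p ∈ ({d, c, b, a} : Finset V))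
    (hq : q ∈ ({d, c, b, a} : Finset V)) (hpq : G.Adj p q) (hvp : G.Adj v p) (hvq : G.Adj v q) :
    Pairable G (insert v {d, c, b, a}) := by
  have hex := h.excess_le
  have hcd := h.not_adj hG
  have hdc : ¬ G.Adj d c := fun h => hcd h.symm
  have hnb : ∀ x ∈ ({d, c, b, a} : Finset V), G.Adj v x → x = p ∨ x = q := fun x hx hvx =>
    eq_or_eq_of_adj hG hv hp hq hpq.ne hvp hvq (Finset.card_le_four.trans (by norm_num))
      (by omega) hx hvx
  have key : ∀ T ⊆ insert v {d, c, b, a}, G.IsNClique 3 T →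
      (a ∈ T ∧ b ∈ T) ∨ (v ∈ T ∧ p ∈ T ∧ q ∈ T) := by
    intro T hT hc
    by_cases hvT : v ∈ T
    · right
      obtain ⟨x, y, hvx, hvy, hxy, rfl⟩ := exists_eq_triple_of_mem hc hvT
      have := hvx.ne
      have := hvy.ne
      have hx : x ∈ insert v ({d, c, b, a} : Finset V) := hT (by simp)
      have hy : y ∈ insert v ({d, c, b, a} : Finset V) := hT (by simp)
      have := hxy.ne
      have := hnb x (by grind) hvx
      have := hnb y (by grind) hvy
      grind
    · left
      exact h.mem_of_clique hG ((Finset.subset_insert_iff_of_notMem hvT).1 hT) hc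
  simp only [Finset.mem_insert, Finset.mem_singleton, not_or] at hv hp hq
  have hab := h.hubs.ne
  have hac := h.ac.ne
  have hbc := h.bc.ne
  have had := h.ad.ne
  have hbd := h.bd.ne
  have hpq' := hpq.ne
  by_cases hhub : (p = a ∧ q = b) ∨ (p = b ∧ q = a)
  · exact pairable_of_one_pair hab (by simp) (by simp) fun T hT hc => by
      rcases key T hT hc with h | h
      · exact h
      · grind
  · have hcd' := h.tips
    obtain ⟨r, hr, hr'⟩ : ∃ r, (r = c ∨ r = d) ∧ (r = p ∨ r = q) := by
      by_cases hpc : p = c ∨ p = d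
      · exact ⟨p, hpc, .inl rfl⟩
      · exact ⟨q, by grind, .inr rfl⟩
    refine pairable_of_two_pairs (a := a) (b := b) (c := r) (d := v) hab ?_ ?_ ?_ ?_ ?_ ?_
      fun T hT hc => ?_
    · grind
    · grind
    · grind
    · grind
    · grind
    · grind
    · rcases key T hT hc with h | h
      · exact .inl h
      · grind

end Structure

section Diamonds

variable {V : Type*} {G : SimpleGraph V}

/-- Two diamonds that share exactly a hub form a double diamond. -/
lemma IsDiamond.doubleDiamond_isContained {x y₁ z₁ z₂ y₂ z₃ z₄ : V}
    (h₁ : IsDiamond G x y₁ z₁ z₂) (h₂ : IsDiamond G x y₂ z₃ z₄)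
    (hy : y₂ ≠ y₁ ∧ y₂ ≠ z₁ ∧ y₂ ≠ z₂) (hz₃ : z₃ ≠ y₁ ∧ z₃ ≠ z₁ ∧ z₃ ≠ z₂)
    (hz₄ : z₄ ≠ y₁ ∧ z₄ ≠ z₁ ∧ z₄ ≠ z₂) : doubleDiamond.IsContained G := by
  refine ⟨⟨⟨![x, y₁, z₁, z₂, y₂, z₃, z₄], ?_⟩, ?_⟩⟩
  · intro i j hij
    simp only [doubleDiamond, SimpleGraph.fromEdgeSet_adj, Set.mem_insert_iff,
      Set.mem_singleton_iff, Sym2.eq_iff] at hij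
    obtain ⟨h, -⟩ := hij
    rcases h with (⟨rfl, rfl⟩ | ⟨rfl, rfl⟩) | (⟨rfl, rfl⟩ | ⟨rfl, rfl⟩) |
      (⟨rfl, rfl⟩ | ⟨rfl, rfl⟩) | (⟨rfl, rfl⟩ | ⟨rfl, rfl⟩) | (⟨rfl, rfl⟩ | ⟨rfl, rfl⟩) |
      (⟨rfl, rfl⟩ | ⟨rfl, rfl⟩) | (⟨rfl, rfl⟩ | ⟨rfl, rfl⟩) | (⟨rfl, rfl⟩ | ⟨rfl, rfl⟩) |
      (⟨rfl, rfl⟩ | ⟨rfl, rfl⟩) | (⟨rfl, rfl⟩ | ⟨rfl, rfl⟩)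
    exacts [h₁.hubs, h₁.hubs.symm, h₁.ac, h₁.ac.symm, h₁.ad, h₁.ad.symm, h₁.bc, h₁.bc.symm,
      h₁.bd, h₁.bd.symm, h₂.hubs, h₂.hubs.symm, h₂.ac, h₂.ac.symm, h₂.ad, h₂.ad.symm,
      h₂.bc, h₂.bc.symm, h₂.bd, h₂.bd.symm]
  · have := h₁.hubs.ne
    have := h₁.ac.ne
    have := h₁.ad.ne
    have := h₁.bc.ne
    have := h₁.bd.ne
    have := h₁.tips
    have := h₂.hubs.ne
    have := h₂.ac.ne
    have := h₂.ad.ne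
    have := h₂.bc.ne
    have := h₂.bd.ne
    have := h₂.tips
    have hnd : [x, y₁, z₁, z₂, y₂, z₃, z₄].Nodup := by
      simp only [List.nodup_cons, List.mem_cons, List.not_mem_nil]
      grind
    exact List.nodup_ofFn.1 hnd

variable [DecidableEq V]

/-- Attach a triangle `s u w` to a diamond at `s`, and then a vertex `v` over an edge of this
triangle. In the absence of double diamonds, the triangles in the resulting set can be paired. -/
lemma IsDiamond.pairable_insert_attach (hG : Sparse G) (hDD : ¬ doubleDiamond.IsContained G)
    {a b c d s u w v p q : V} (h : IsDiamond G a b c d)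
    (hs : s ∈ ({d, c, b, a} : Finset V)) (hu : u ∉ ({d, c, b, a} : Finset V))
    (hw : w ∉ ({d, c, b, a} : Finset V)) (hsu : G.Adj s u) (hsw : G.Adj s w) (huw : G.Adj u w)
    (hv : v ∉ insert w (insert u ({d, c, b, a} : Finset V)))
    (hp : p ∈ insert w (insert u ({d, c, b, a} : Finset V)))
    (hq : q ∈ insert w (insert u ({d, c, b, a} : Finset V)))
    (hpqD : ¬ (p ∈ ({d, c, b, a} : Finset V) ∧ q ∈ ({d, c, b, a} : Finset V)))
    (hpq : G.Adj p q) (hvp : G.Adj v p) (hvq : G.Adj v q) :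
    Pairable G (insert v (insert w (insert u {d, c, b, a}))) := by
  have hex := h.excess_le
  have hcard : ({d, c, b, a} : Finset V).card ≤ 4 := Finset.card_le_four
  have hcard' := card_insert_insert_le ({d, c, b, a} : Finset V) u w
  have hex' := excess_attach hs hu hw hsu hsw huw
  have hnbv : ∀ x ∈ insert w (insert u ({d, c, b, a} : Finset V)), G.Adj v x → x = p ∨ x = q :=
    fun x hx hvx => eq_or_eq_of_adj hG hv hp hq hpq.ne hvp hvq (by omega) (by omega) hx hvx
  have hnb : ∀ x ∈ ({d, c, b, a} : Finset V), G.Adj u x ∨ G.Adj w x → x = s := by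
    intro x hx hux
    by_contra hne
    have h1 := excess_attach_extra hs hu hw hsu hsw huw hx hne hux
    have h2 := hG (insert w (insert u {d, c, b, a})) (by omega)
    omega
  have hclique : ∀ T ⊆ ({d, c, b, a} : Finset V), G.IsNClique 3 T → a ∈ T ∧ b ∈ T :=
    fun _ => h.mem_of_clique hG
  have haD : a ∈ ({d, c, b, a} : Finset V) := by simp
  have hbD : b ∈ ({d, c, b, a} : Finset V) := by simp
  have hcD : c ∈ ({d, c, b, a} : Finset V) := by simp
  have hdD : d ∈ ({d, c, b, a} : Finset V) := by simp
  generalize ({d, c, b, a} : Finset V) = D at *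
  have key : ∀ T ⊆ insert v (insert w (insert u D)), G.IsNClique 3 T →
      (a ∈ T ∧ b ∈ T) ∨ (v ∈ T ∧ p ∈ T ∧ q ∈ T) ∨ (s ∈ T ∧ u ∈ T ∧ w ∈ T) := by
    intro T hT hc
    by_cases hvT : v ∈ T
    · obtain ⟨x, y, hvx, hvy, hxy, rfl⟩ := exists_eq_triple_of_mem hc hvT
      have hx := hnbv x ((Finset.mem_insert.1 (hT (by simp))).resolve_left hvx.ne') hvx
      have hy := hnbv y ((Finset.mem_insert.1 (hT (by simp))).resolve_left hvy.ne') hvy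
      have := hxy.ne
      grind
    · have hT' := (Finset.subset_insert_iff_of_notMem hvT).1 hT
      by_cases hTD : T ⊆ D
      · exact .inl (hclique T hTD hc)
      · right; right
        obtain ⟨t, ht, htD⟩ := Finset.not_subset.1 hTD
        obtain ⟨x, y, htx, hty, hxy, rfl⟩ := exists_eq_triple_of_mem hc ht
        have hxT : x ∈ insert w (insert u D) := hT' (by simp)
        have hyT : y ∈ insert w (insert u D) := hT' (by simp)
        have htT : t ∈ insert w (insert u D) := hT' (by simp)
        have := htx.ne
        have := hty.ne
        have := hxy.ne
        have := hnb x
        have := hnb y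
        grind
  have hpq2 : (p = s ∨ p = u ∨ p = w) ∧ (q = s ∨ q = u ∨ q = w) := by
    have := hnb p
    have := hnb q
    have := hpq.symm
    grind
  have hvw : v ≠ w := by grind
  have hvu : v ≠ u := by grind
  have hvD : v ∉ D := by grind
  have hab := h.hubs.ne
  have hac := h.ac.ne
  have hbc := h.bc.ne
  have had := h.ad.ne
  have hbd := h.bd.ne
  have huw' := huw.ne
  have hpq' := hpq.ne
  have hsu' := hsu.ne
  have hsw' := hsw.ne
  by_cases hps : p = s ∨ q = s
  · -- The second diamond has the hubs `s` and `r`, where `r` is one of `u` and `w`.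
    obtain ⟨r, r', hr, hrr, hr2⟩ : ∃ r r', ((r = u ∧ r' = w) ∨ (r = w ∧ r' = u)) ∧
        G.Adj v r ∧ ((p = s ∧ q = r) ∨ (p = r ∧ q = s)) := by
      rcases hps with rfl | rfl
      · by_cases q = u
        · exact ⟨u, w, by grind, by grind, by grind⟩
        · exact ⟨w, u, by grind, by grind, by grind⟩
      · by_cases p = u
        · exact ⟨u, w, by grind, by grind, by grind⟩
        · exact ⟨w, u, by grind, by grind, by grind⟩
    have h2 : IsDiamond G s r r' v := by
      have := huw.symm
      have := hvp.symm
      have := hvq.symm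
      constructor <;> grind
    have hrD : r ∉ D := by grind
    have hrD' : r' ∉ D := by grind
    have hne : ∀ x ∉ D, x ≠ a ∧ x ≠ b ∧ x ≠ c ∧ x ≠ d := fun x hx =>
      ⟨by grind, by grind, by grind, by grind⟩
    have hrr' := hne r hrD
    have hrr'' := hne r' hrD'
    have hvv := hne v hvD
    have hsa : s ≠ a := by
      rintro rfl
      exact hDD (h.doubleDiamond_isContained h2 hrr'.2 hrr''.2 hvv.2)
    have hsb : s ≠ b := by
      rintro rfl
      exact hDD (h.swap_hubs.doubleDiamond_isContained h2 ⟨hrr'.1, hrr'.2.2⟩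
        ⟨hrr''.1, hrr''.2.2⟩ ⟨hvv.1, hvv.2.2⟩)
    refine pairable_of_two_pairs (a := a) (b := b) (c := s) (d := r) hab h2.hubs.ne hsa.symm
      hrr'.1.symm hsb.symm hrr'.2.1.symm ?_ fun T hT hc => ?_
    · grind
    · have := key T hT hc
      grind
  · refine pairable_of_two_pairs (a := a) (b := b) (c := u) (d := w) hab huw' ?_ ?_ ?_ ?_ ?_
      fun T hT hc => ?_
    · grind
    · grind
    · grind
    · grind
    · grind
    · have := key T hT hc
      grind

/-- After at most two steps that enlarge the diamond, the excess is at most `3`. The sets reached in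
this way can be paired, since a double diamond, the only obstruction, is excluded. -/
lemma MinimalUnpairable.false_of_diamond (hG : Sparse G) (hDD : ¬ doubleDiamond.IsContained G)
    {W : Finset V} (hW : MinimalUnpairable G W) {a b c d : V} (h : IsDiamond G a b c d)
    (haW : a ∈ W) (hbW : b ∈ W) (hcW : c ∈ W) (hdW : d ∈ W) : False := by
  have hcard : ({d, c, b, a} : Finset V).card ≤ 4 := Finset.card_le_four
  have hDW : ({d, c, b, a} : Finset V) ⊆ W := by grind
  have hex := h.excess_le
  have hE : ∀ v ∈ W, v ∉ ({d, c, b, a} : Finset V) → ∀ p ∈ ({d, c, b, a} : Finset V),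
      ∀ q ∈ ({d, c, b, a} : Finset V), G.Adj p q → G.Adj v p → G.Adj v q → False := by
    intro v hv hvD p hp q hq hpq hvp hvq
    have h1 := excess_insert_two hvD hp hq hpq.ne hvp hvq
    have h2 := Finset.card_insert_le v ({d, c, b, a} : Finset V)
    exact hW.false_of_excess_le_three hG 1 (by norm_num) (S := insert v {d, c, b, a})
      (Finset.insert_subset hv hDW) (by simp) (h.pairable_insert hG hvD hp hq hpq hvp hvq)
      (by omega) (by push_cast; omega)
  rcases hW.exists_attached hDW (by simp) (h.pairable hG) with
    ⟨s, hs, t, ht, v, hv, hvS, hst, hvs, hvt⟩ | ⟨s, hs, u, hu, w, hw, huS, hwS, hsu, hsw, huw⟩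
  · exact hE v hv hvS s hs t ht hst hvs hvt
  have h1 := excess_attach hs huS hwS hsu hsw huw
  have h2 := card_insert_insert_le ({d, c, b, a} : Finset V) u w
  have hS := (h.pairable hG).attach_of_excess hG hs huS hwS hsu hsw huw (by omega) (by omega)
  have hSW : insert w (insert u ({d, c, b, a} : Finset V)) ⊆ W :=
    Finset.insert_subset hw (Finset.insert_subset hu hDW)
  rcases hW.exists_attached hSW (by simp) hS with
    ⟨p, hp, q, hq, v, hv, hvS, hpq, hvp, hvq⟩ | ⟨t, ht, x, hx, y, hy, hxS, hyS, htx, hty, hxy⟩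
  · by_cases hpqD : p ∈ ({d, c, b, a} : Finset V) ∧ q ∈ ({d, c, b, a} : Finset V)
    · exact hE v hv (fun h => hvS (Finset.mem_insert_of_mem (Finset.mem_insert_of_mem h))) p hpqD.1 q hpqD.2 hpq hvp hvq
    · have h3 := excess_insert_two hvS hp hq hpq.ne hvp hvq
      have h4 := Finset.card_insert_le v (insert w (insert u ({d, c, b, a} : Finset V)))
      exact hW.false_of_excess_le_three hG 0 (by norm_num) (Finset.insert_subset hv hSW) (by simp)
        (h.pairable_insert_attach hG hDD hs huS hwS hsu hsw huw hvS hp hq hpqD hpq hvp hvq)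
        (by omega) (by push_cast; omega)
  · have h3 := excess_attach ht hxS hyS htx hty hxy
    have h4 := card_insert_insert_le (insert w (insert u ({d, c, b, a} : Finset V))) x y
    exact hW.false_of_excess_le_three hG 3 (by norm_num)
      (Finset.insert_subset hy (Finset.insert_subset hx hSW)) (by simp)
      (hS.attach_of_excess hG ht hxS hyS htx hty hxy (by omega) (by omega))
      (by omega) (by push_cast; omega)

/-- Without diamonds in `W`, attach triangles at single vertices. As long as every edge inside the
current set lies in a triangle of the set, no triangle can be attached along an edge; the first
additional edge makes the excess small enough for `false_of_excess_le_three`. -/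
lemma MinimalUnpairable.false_of_no_diamond (hG : Sparse G)
    {W : Finset V} (hW : MinimalUnpairable G W)
    (hdia : ∀ a ∈ W, ∀ b ∈ W, ∀ c ∈ W, ∀ d ∈ W, ¬ IsDiamond G a b c d)
    (k : ℕ) {S : Finset V} (hSW : S ⊆ W) (hne : S.Nonempty) (hS : Pairable G S)
    (htri : ∀ x ∈ S, ∀ y ∈ S, G.Adj x y → ∃ z ∈ S, G.Adj x z ∧ G.Adj y z)
    (hk : k ≤ 9) (hcard : S.card + 2 * k ≤ 21) (hex : excess G S ≤ k) : False := by
  induction k generalizing S with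
  | zero =>
    exact hW.false_of_excess_le_three hG 0 (by norm_num) hSW hne hS (by omega) hex
  | succ k ih =>
    rcases hW.exists_attached hSW hne hS with
      ⟨s, hs, t, ht, v, hv, hvS, hst, hvs, hvt⟩ | ⟨s, hs, u, hu, w, hw, huS, hwS, hsu, hsw, huw⟩
    · obtain ⟨z, hz, hsz, htz⟩ := htri s hs t ht hst
      exact hdia s (hSW hs) t (hSW ht) z (hSW hz) v hv
        ⟨hst, hsz, htz, hvs.symm, hvt.symm, fun h => hvS (h ▸ hz)⟩
    have h1 := excess_attach hs huS hwS hsu hsw huw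
    have h2 := card_insert_insert_le S u w
    have hS'W : insert w (insert u S) ⊆ W :=
      Finset.insert_subset hw (Finset.insert_subset hu hSW)
    have hnew : ∀ v v' : V, v ∈ W → v' ∈ W → v ∉ S → v' ∉ S → G.Adj s v → G.Adj s v' →
        G.Adj v v' → ∀ x ∈ S, ∀ y ∈ S, G.Adj x y → ¬ (G.Adj v x ∧ G.Adj v y) := by
      rintro v v' hv hv' hvS hvS' hsv hsv' hvv' x hx y hy hxy ⟨hvx, hvy⟩
      by_cases hxs : x = s
      · subst hxs
        exact hdia x (hSW hs) v hv y (hSW hy) v' hv' ⟨hsv, hxy, hvy, hsv', hvv',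
          fun h => hvS' (h ▸ hy)⟩
      by_cases hys : y = s
      · subst hys
        exact hdia y (hSW hs) v hv x (hSW hx) v' hv' ⟨hsv, hxy.symm, hvx, hsv', hvv',
          fun h => hvS' (h ▸ hx)⟩
      have h3 := excess_insert_three hvS hs hx hy (Ne.symm hxs) (Ne.symm hys) hxy.ne hsv.symm hvx hvy
      have h4 := hG (insert v S) ((Finset.card_insert_le _ _).trans (by omega))
      omega
    have hS' : Pairable G (insert w (insert u S)) :=
      hS.attach huS hwS huw fun x hx y hy hxy =>
        ⟨hnew u w hu hw huS hwS hsu hsw huw x hx y hy hxy,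
         hnew w u hw hu hwS huS hsw hsu huw.symm x hx y hy hxy⟩
    by_cases hextra : ∃ s' ∈ S, s' ≠ s ∧ (G.Adj u s' ∨ G.Adj w s')
    · obtain ⟨s', hs', hne', h⟩ := hextra
      have h3 := excess_attach_extra hs huS hwS hsu hsw huw hs' hne' h
      exact hW.false_of_excess_le_three hG 1 (by norm_num) hS'W (by simp) hS' (by omega)
        (by push_cast at *; omega)
    · push Not at hextra
      refine ih hS'W (by simp) hS' ?_ (by omega) (by omega) (by push_cast at *; omega)
      have hu' : ∀ x ∈ S, G.Adj u x → x = s := fun x hx hux => by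
        by_contra hne
        exact (hextra x hx hne).1 hux
      have hw' : ∀ x ∈ S, G.Adj w x → x = s := fun x hx hwx => by
        by_contra hne
        exact (hextra x hx hne).2 hwx
      have hus := hsu.symm
      have hws := hsw.symm
      have hwu := huw.symm
      intro x hx y hy hxy
      have hyx := hxy.symm
      have := hxy.ne
      simp only [Finset.mem_insert] at hx hy
      by_cases hxS : x ∈ S
      · by_cases hyS : y ∈ S
        · obtain ⟨z, hz, h⟩ := htri x hxS y hyS hxy
          exact ⟨z, by simp [hz], h⟩
        · rcases hy with rfl | rfl | hy
          · obtain rfl := hw' x hxS hyx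
            exact ⟨u, by simp, hsu, hwu⟩
          · obtain rfl := hu' x hxS hyx
            exact ⟨w, by simp, hsw, huw⟩
          · exact absurd hy hyS
      · by_cases hyS : y ∈ S
        · rcases hx with rfl | rfl | hx
          · obtain rfl := hw' y hyS hxy
            exact ⟨u, by simp, hwu, hsu⟩
          · obtain rfl := hu' y hyS hxy
            exact ⟨w, by simp, huw, hsw⟩
          · exact absurd hx hxS
        · refine ⟨s, by simp [hs], ?_, ?_⟩ <;> grind

/-- The triangles of a sparse graph without double diamonds can be paired. -/
theorem pairable_of_sparse (hG : Sparse G) (hDD : ¬ doubleDiamond.IsContained G)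
    (W : Finset V) : Pairable G W := by
  by_contra hW
  obtain ⟨W, hW⟩ := exists_minimalUnpairable hW
  by_cases hdia : ∀ a ∈ W, ∀ b ∈ W, ∀ c ∈ W, ∀ d ∈ W, ¬ IsDiamond G a b c d
  · obtain ⟨T, hTW, hT⟩ : ∃ T ⊆ W, G.IsNClique 3 T := by
      by_contra hno
      push Not at hno
      exact hW.not_pairable ⟨id, ⟨fun _ => rfl, fun _ _ => rfl⟩,
        fun T hTW hT => absurd hT (hno T hTW)⟩
    obtain ⟨a, b, c, hab, hac, hbc, rfl⟩ := SimpleGraph.is3Clique_iff.1 hT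
    have h0 := excess_singleton (G := G) c
    have h1 := excess_insert_one (G := G) (S := {c}) (v := b) (x := c)
      (by simp [hbc.ne]) (by simp) hbc
    have h2 := excess_insert_two (G := G) (S := {b, c}) (v := a) (x := b) (y := c)
      (by simp [hab.ne, hac.ne]) (by simp) (by simp) hbc.ne hab hac
    have h3 : ({a, b, c} : Finset V).card ≤ 3 := Finset.card_le_three
    refine hW.false_of_no_diamond hG hdia 9 hTW (by simp) ?_ ?_ le_rfl (by omega)
      (by push_cast; omega)
    · refine pairable_of_one_pair hab.ne (by simp) (by simp) fun T hTs hTc => ?_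
      have : T = {a, b, c} := Finset.eq_of_subset_of_card_le hTs (by rw [hTc.card_eq]; exact h3)
      simp [this]
    · intro x hx y hy hxy
      have := hxy.ne
      have := hab.symm
      have := hac.symm
      have := hbc.symm
      have h : ∃ z ∈ ({a, b, c} : Finset V), z ≠ x ∧ z ≠ y := by
        by_cases ha : a ≠ x ∧ a ≠ y
        · exact ⟨a, by simp, ha⟩
        by_cases hb : b ≠ x ∧ b ≠ y
        · exact ⟨b, by simp, hb⟩
        · exact ⟨c, by simp, by have := hac.ne; have := hbc.ne; have := hab.ne; grind⟩
      obtain ⟨z, hz, hzx, hzy⟩ := h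
      exact ⟨z, hz, by grind, by grind⟩
  · push Not at hdia
    obtain ⟨a, ha, b, hb, c, hc, d, hd, h⟩ := hdia
    exact hW.false_of_diamond hG hDD h ha hb hc hd

end Diamonds

/-! ### Strategies in the vertex game -/

section Game

variable {V : Type}

lemma isDiamond_of_copy {G : SimpleGraph V} (f : doubleDiamond.Copy G) :
    IsDiamond G (f 0) (f 1) (f 2) (f 3) ∧ IsDiamond G (f 0) (f 4) (f 5) (f 6) := by
  have hadj : ∀ i j : Fin 7, s(i, j) ∈ ({s(0, 1), s(0, 2), s(0, 3), s(1, 2), s(1, 3),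
     s(0, 4), s(0, 5), s(0, 6), s(4, 5), s(4, 6)} : Set (Sym2 (Fin 7))) → i ≠ j →
     G.Adj (f i) (f j) := fun i j h hij =>
    f.toHom.map_adj ((SimpleGraph.fromEdgeSet_adj _).2 ⟨h, hij⟩)
  have hinj := f.injective
  refine ⟨⟨?_, ?_, ?_, ?_, ?_, ?_⟩, ⟨?_, ?_, ?_, ?_, ?_, ?_⟩⟩
  all_goals first
    | exact hadj _ _ (by simp) (by decide)
    | exact fun h => absurd (hinj h) (by decide)

variable [DecidableEq V]

/-- Breaker's pairing strategy, with Maker to move: if every winning set that avoids `B₀` contains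
a pair of `σ`, and Breaker owns `B₀` as well as the partners of Maker's elements, then Breaker wins.

When Breaker is to move, the partner of Maker's last element `v₀` may still be free. -/
theorem not_makerWinsFrom_of_pairing {Wins : Finset V → Prop} {σ : V → V}
    (hσ : ∀ x, σ (σ x) = x) {B₀ : Finset V}
    (hwin : ∀ M, Wins M → Disjoint M B₀ → ContainsPair σ M)
    {M B : Finset V} (hB : B₀ ⊆ B) (hMB : Disjoint M B)
    (hM : ∀ v ∈ M, σ v ≠ v → σ v ∈ B) :
    ¬ MakerWinsFrom Wins .maker M B := by
  have key : ∀ turn (M B : Finset V), MakerWinsFrom Wins turn M B → B₀ ⊆ B → Disjoint M B →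
      (match turn with
        | .maker => ∀ v ∈ M, σ v ≠ v → σ v ∈ B
        | .breaker => ∃ v₀ ∈ M, ∀ v ∈ M, v ≠ v₀ → σ v ≠ v → σ v ∈ B) → False := by
    intro turn M B h
    induction h with
    | gameOver turn M B hfull hw =>
      intro hB hMB hinv
      obtain ⟨x, hx, hx', hne⟩ := hwin M hw (hMB.mono_right hB)
      rw [Finset.disjoint_left] at hMB
      cases turn with
      | maker => exact hMB hx' (hinv x hx hne)
      | breaker =>
        obtain ⟨v₀, -, hv₀⟩ := hinv
        by_cases h : x = v₀
        · have := hv₀ (σ x) hx' (h ▸ hne) (by rw [hσ]; exact hne.symm)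
          rw [hσ] at this
          exact hMB hx this
        · exact hMB hx' (hv₀ x hx h hne)
    | makerMove M B v hfree _ ih =>
      intro hB hMB hinv
      rw [Finset.mem_union, not_or] at hfree
      refine ih hB (Finset.disjoint_insert_left.2 ⟨hfree.2, hMB⟩)
        ⟨v, Finset.mem_insert_self _ _, fun w hw hwv => hinv w ?_⟩
      exact (Finset.mem_insert.1 hw).resolve_left hwv
    | breakerMove M B hexists _ ih =>
      rintro hB hMB ⟨v₀, hv₀M, hv₀⟩
      have hins : ∀ v, v ∉ M ∪ B → Disjoint M (insert v B) := fun v hv =>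
        Finset.disjoint_insert_right.2 ⟨fun h => hv (Finset.mem_union_left _ h), hMB⟩
      by_cases hfree : σ v₀ ∈ M ∪ B
      · obtain ⟨w, hw⟩ := hexists
        refine ih w hw (hB.trans (Finset.subset_insert _ _)) (hins w hw) fun v hv hne => ?_
        refine Finset.mem_insert_of_mem ?_
        by_cases h : v = v₀
        · subst h
          refine (Finset.mem_union.1 hfree).resolve_left fun hσM => ?_
          have := hv₀ (σ v) hσM hne (by rw [hσ]; exact hne.symm)
          rw [hσ] at this
          exact Finset.disjoint_left.1 hMB hv this
        · exact hv₀ v hv h hne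
      · refine ih (σ v₀) hfree (hB.trans (Finset.subset_insert _ _)) (hins _ hfree)
          fun v hv hne => ?_
        by_cases h : v = v₀
        · subst h
          exact Finset.mem_insert_self _ _
        · exact Finset.mem_insert_of_mem (hv₀ v hv h hne)
  exact fun h => key _ _ _ h hB hMB hM

/-- Once Maker owns a winning set, he wins. -/
lemma makerWinsFrom_of_wins [Fintype V] {Wins : Finset V → Prop}
    (hmono : ∀ M M', M ⊆ M' → Wins M → Wins M') (turn : Player) {M B : Finset V} (h : Wins M) :
    MakerWinsFrom Wins turn M B := by
  by_cases hfull : ∀ v, v ∈ M ∪ B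
  · exact .gameOver turn M B hfull h
  · push Not at hfull
    obtain ⟨v, hv⟩ := hfull
    have hlt : ∀ v, v ∉ M ∪ B → (insert v (M ∪ B))ᶜ.card < (M ∪ B)ᶜ.card := fun v hv =>
      Finset.card_lt_card (Finset.compl_ssubset_compl.2 (Finset.ssubset_insert hv))
    cases turn with
    | maker =>
      have := hlt v hv
      refine .makerMove M B v hv (makerWinsFrom_of_wins hmono _ (hmono _ _ ?_ h))
      exact Finset.subset_insert _ _
    | breaker =>
      refine .breakerMove M B ⟨v, hv⟩ fun w hw => ?_
      have := hlt w hw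
      exact makerWinsFrom_of_wins hmono _ h
termination_by (M ∪ B)ᶜ.card
decreasing_by
  · rwa [Finset.insert_union]
  · rwa [Finset.union_insert]

/-- The property that Maker's vertices contain a triangle. -/
abbrev HasTriangle (G : SimpleGraph V) (M : Finset V) : Prop :=
  triangleGraph.IsContained (G.induce (M : Set V))

lemma hasTriangle_iff (G : SimpleGraph V) (M : Finset V) :
    HasTriangle G M ↔ ∃ T ⊆ M, G.IsNClique 3 T := by
  constructor
  · rintro ⟨f⟩
    have hadj : ∀ i j : Fin 3, i ≠ j → G.Adj (f i).1 (f j).1 := fun i j hij =>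
      f.toHom.map_adj (show (⊤ : SimpleGraph (Fin 3)).Adj i j from hij)
    refine ⟨{(f 0).1, (f 1).1, (f 2).1}, ?_, SimpleGraph.is3Clique_iff.2
      ⟨_, _, _, hadj 0 1 (by decide), hadj 0 2 (by decide), hadj 1 2 (by decide), rfl⟩⟩
    intro x hx
    simp only [Finset.mem_insert, Finset.mem_singleton] at hx
    rcases hx with rfl | rfl | rfl
    · exact (f 0).2
    · exact (f 1).2
    · exact (f 2).2
  · rintro ⟨T, hTM, hT⟩
    obtain ⟨a, b, c, hab, hac, hbc, rfl⟩ := SimpleGraph.is3Clique_iff.1 hT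
    have hmem : ∀ x ∈ ({a, b, c} : Finset V), x ∈ (M : Set V) := fun x hx => hTM hx
    refine ⟨⟨⟨![⟨a, hmem a (by simp)⟩, ⟨b, hmem b (by simp)⟩, ⟨c, hmem c (by simp)⟩], ?_⟩, ?_⟩⟩
    · intro i j hij
      have hij : i ≠ j := hij
      have := hab.symm
      have := hac.symm
      have := hbc.symm
      fin_cases i <;> fin_cases j <;> simp_all
    · have hnd : [(⟨a, hmem a (by simp)⟩ : (M : Set V)), ⟨b, hmem b (by simp)⟩,
          ⟨c, hmem c (by simp)⟩].Nodup := by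
        simp [hab.ne, hac.ne, hbc.ne]
      exact List.nodup_ofFn.1 hnd

lemma HasTriangle.mono {G : SimpleGraph V} (M M' : Finset V) (h : M ⊆ M')
    (hM : HasTriangle G M) : HasTriangle G M' := by
  rw [hasTriangle_iff] at *
  obtain ⟨T, hT, hc⟩ := hM
  exact ⟨T, hT.trans h, hc⟩

/-- If Maker owns a hub of a diamond whose other vertices are free and he is to move, then he takes
the other hub and threatens to take either tip. -/
lemma makerWinsFrom_of_diamond [Fintype V] {G : SimpleGraph V} {M B : Finset V} {x y z z' : V}
    (h : IsDiamond G x y z z') (hx : x ∈ M) (hy : y ∉ M ∪ B) (hz : z ∉ M ∪ B)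
    (hz' : z' ∉ M ∪ B) : MakerWinsFrom (HasTriangle G) .maker M B := by
  have hyz := h.bc.ne
  have hyz' := h.bd.ne
  have hzz := h.tips
  have hfree : ∀ t, t ≠ y → t ∉ M ∪ B → t ∉ insert y M ∪ B := by
    intro t hty ht
    simp only [Finset.mem_union, Finset.mem_insert] at *
    tauto
  refine .makerMove M B y hy (.breakerMove _ _ ⟨z, hfree z hyz.symm hz⟩ fun w hw => ?_)
  have key : ∀ t, t ≠ w → t ∉ insert y M ∪ B → G.Adj x t → G.Adj y t →
      MakerWinsFrom (HasTriangle G) .maker (insert y M) (insert w B) := by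
    intro t htw ht hxt hyt
    refine .makerMove _ _ t ?_ (makerWinsFrom_of_wins HasTriangle.mono _ ?_)
    · rw [Finset.union_insert, Finset.mem_insert, not_or]
      exact ⟨htw, ht⟩
    · rw [hasTriangle_iff]
      refine ⟨{x, y, t}, ?_, SimpleGraph.is3Clique_iff.2 ⟨x, y, t, h.hubs, hxt, hyt, rfl⟩⟩
      intro a ha
      simp only [Finset.mem_insert, Finset.mem_singleton] at ha ⊢
      rcases ha with rfl | rfl | rfl <;> simp [hx]
  by_cases hzw : z = w
  · exact key z' (fun h => hzz (hzw.trans h.symm)) (hfree z' hyz'.symm hz') h.ad h.bd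
  · exact key z hzw (hfree z hyz.symm hz) h.ac h.bc

/-- Maker, moving first, wins on a double diamond of free vertices: he takes the centre, and then
Breaker can spoil only one of the two diamonds. -/
theorem makerWinsFrom_of_copy [Fintype V] {G : SimpleGraph V} (f : doubleDiamond.Copy G)
    {M B : Finset V} (hf : ∀ i, f i ∉ M ∪ B) : MakerWinsFrom (HasTriangle G) .maker M B := by
  obtain ⟨h₁, h₂⟩ := isDiamond_of_copy f
  have hinj := f.injective
  have hfree : ∀ i, i ≠ 0 → f i ∉ insert (f 0) M ∪ B := by
    intro i hi
    rw [Finset.insert_union, Finset.mem_insert, not_or]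
    exact ⟨fun h => hi (hinj h), hf i⟩
  refine .makerMove M B (f 0) (hf 0) (.breakerMove _ _ ⟨f 1, hfree 1 (by decide)⟩ fun w hw => ?_)
  have hfree' : ∀ i, i ≠ 0 → f i ≠ w → f i ∉ insert (f 0) M ∪ insert w B := by
    intro i hi hiw
    rw [Finset.union_insert, Finset.mem_insert, not_or]
    exact ⟨hiw, hfree i hi⟩
  by_cases h : f 1 ≠ w ∧ f 2 ≠ w ∧ f 3 ≠ w
  · exact makerWinsFrom_of_diamond h₁ (Finset.mem_insert_self _ _) (hfree' 1 (by decide) h.1)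
      (hfree' 2 (by decide) h.2.1) (hfree' 3 (by decide) h.2.2)
  · have hne : ∀ j : Fin 7, j ≠ 1 → j ≠ 2 → j ≠ 3 → f j ≠ w := by
      rintro j h1 h2 h3 rfl
      exact h ⟨fun h => h1 (hinj h).symm, fun h => h2 (hinj h).symm, fun h => h3 (hinj h).symm⟩
    exact makerWinsFrom_of_diamond h₂ (Finset.mem_insert_self _ _)
      (hfree' 4 (by decide) (hne 4 (by decide) (by decide) (by decide)))
      (hfree' 5 (by decide) (hne 5 (by decide) (by decide) (by decide)))
      (hfree' 6 (by decide) (hne 6 (by decide) (by decide) (by decide)))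

end Game

/-! ### Edge counts in double diamonds -/

section DoubleDiamond

/-- The edges of the double diamond as ordered pairs `(i, j)` with `i < j`. -/
def ddPairs : Finset (Fin 7 × Fin 7) :=
  {(0, 1), (0, 2), (0, 3), (1, 2), (1, 3), (0, 4), (0, 5), (0, 6), (4, 5), (4, 6)}

/-- The edges of the double diamond inside the vertex set `A`. -/
def ddPairsIn (A : Finset (Fin 7)) : Finset (Fin 7 × Fin 7) :=
  ddPairs.filter fun p => p.1 ∈ A ∧ p.2 ∈ A

lemma card_ddPairs : ddPairs.card = 10 := by decide

lemma card_ddPairsIn_le_ten (A : Finset (Fin 7)) : (ddPairsIn A).card ≤ 10 := by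
  rw [← card_ddPairs]
  exact Finset.card_filter_le _ _

lemma lt_of_mem_ddPairs : ∀ p ∈ ddPairs, p.1 < p.2 := by decide

/-- The double diamond is strictly balanced. -/
lemma card_ddPairsIn_lt :
    ∀ A : Finset (Fin 7), A.Nonempty → A ≠ Finset.univ → 7 * (ddPairsIn A).card < 10 * A.card := by
  decide +kernel

lemma card_ddPairsIn_le (A : Finset (Fin 7)) : 7 * (ddPairsIn A).card ≤ 10 * A.card := by
  rcases A.eq_empty_or_nonempty with rfl | hA
  · simp [ddPairsIn]
  · by_cases h : A = Finset.univ
    · subst h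
      decide
    · exact (card_ddPairsIn_lt A hA h).le

lemma doubleDiamond_adj (i j : Fin 7) :
    doubleDiamond.Adj i j ↔ (i, j) ∈ ddPairs ∨ (j, i) ∈ ddPairs := by
  have h : doubleDiamond.Adj i j ↔ s(i, j) ∈ ({s(0, 1), s(0, 2), s(0, 3), s(1, 2), s(1, 3),
      s(0, 4), s(0, 5), s(0, 6), s(4, 5), s(4, 6)} : Finset (Sym2 (Fin 7))) ∧ i ≠ j := by
    simp [doubleDiamond]
  rw [h]
  clear h
  revert i j
  decide +kernel

variable {V : Type*} {G : SimpleGraph V}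

lemma ddPair_injOn {f : Fin 7 → V} (hf : Function.Injective f) :
    Set.InjOn (fun p : Fin 7 × Fin 7 => s(f p.1, f p.2)) (ddPairs : Set (Fin 7 × Fin 7)) := by
  intro p hp q hq h
  have h1 := lt_of_mem_ddPairs p hp
  have h2 := lt_of_mem_ddPairs q hq
  simp only [Sym2.eq_iff] at h
  rcases h with ⟨ha, hb⟩ | ⟨ha, hb⟩
  · exact Prod.ext (hf ha) (hf hb)
  · have := hf ha
    have := hf hb
    omega

lemma toSubgraph_verts (f : doubleDiamond.Copy G) : f.toSubgraph.verts = Set.range f := by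
  simp [SimpleGraph.Copy.toSubgraph]

variable [DecidableEq V]

/-- The edge set of the copy of the double diamond given by the vertex map `f`. -/
def ddEdges (f : Fin 7 → V) : Finset (Sym2 V) :=
  ddPairs.image fun p => s(f p.1, f p.2)

lemma card_ddEdges {f : Fin 7 → V} (hf : Function.Injective f) : (ddEdges f).card = 10 := by
  rw [ddEdges, Finset.card_image_of_injOn (ddPair_injOn hf), card_ddPairs]

/-- The common edges of two copies of the double diamond are among the edges spanned by the common
vertices. -/
lemma ddEdges_inter_subset (f g : Fin 7 → V) {A : Finset (Fin 7)}
    (hA : ∀ i j, f i = g j → i ∈ A) :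
    ddEdges f ∩ ddEdges g ⊆ (ddPairsIn A).image fun p => s(f p.1, f p.2) := by
  intro e he
  rw [Finset.mem_inter, ddEdges, ddEdges, Finset.mem_image, Finset.mem_image] at he
  obtain ⟨⟨p, hp, rfl⟩, q, hq, hqp⟩ := he
  refine Finset.mem_image.2 ⟨p, Finset.mem_filter.2 ⟨hp, ?_⟩, rfl⟩
  simp only [Sym2.eq_iff] at hqp
  rcases hqp with ⟨h1, h2⟩ | ⟨h1, h2⟩
  · exact ⟨hA _ _ h1.symm, hA _ _ h2.symm⟩
  · exact ⟨hA _ _ h2.symm, hA _ _ h1.symm⟩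

lemma card_ddEdges_inter_le (f g : Fin 7 → V) {A : Finset (Fin 7)}
    (hA : ∀ i j, f i = g j → i ∈ A) :
    (ddEdges f ∩ ddEdges g).card ≤ (ddPairsIn A).card :=
  (Finset.card_le_card (ddEdges_inter_subset f g hA)).trans Finset.card_image_le

lemma ddEdges_subset_edgeSet (f : doubleDiamond.Copy G) :
    ∀ e ∈ ddEdges f, e ∈ G.edgeSet := by
  intro e he
  obtain ⟨p, hp, rfl⟩ := Finset.mem_image.1 he
  exact f.toHom.map_adj ((doubleDiamond_adj _ _).2 (.inl hp))

lemma mem_ddEdges_iff (f : doubleDiamond.Copy G) (a b : V) :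
    s(a, b) ∈ ddEdges f ↔ f.toSubgraph.Adj a b := by
  rw [ddEdges, Finset.mem_image]
  constructor
  · rintro ⟨p, hp, h⟩
    have hadj : f.toSubgraph.Adj (f p.1) (f p.2) :=
      ⟨p.1, p.2, (doubleDiamond_adj _ _).2 (.inl hp), rfl, rfl⟩
    rcases Sym2.eq_iff.1 h with ⟨h1, h2⟩ | ⟨h1, h2⟩
    · exact h1 ▸ h2 ▸ hadj
    · exact h1 ▸ h2 ▸ hadj.symm
  · rintro ⟨i, j, hij, rfl, rfl⟩
    rcases (doubleDiamond_adj _ _).1 hij with h | h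
    · exact ⟨_, h, rfl⟩
    · exact ⟨_, h, Sym2.eq_swap⟩

/-- In a sparse graph, distinct double diamonds are disjoint, because the double diamond is
strictly balanced. -/
theorem Sparse.disjoint_copies (hG : Sparse G) (f g : doubleDiamond.Copy G)
    (hne : f.toSubgraph ≠ g.toSubgraph) (i j : Fin 7) : f i ≠ g j := by
  classical
  intro hij
  have hf : Function.Injective f := f.injective
  have hg : Function.Injective g := g.injective
  set A : Finset (Fin 7) := Finset.univ.filter fun i => ∃ j, f i = g j with hA
  have hcardf : (Finset.univ.image f).card = 7 := by
    rw [Finset.card_image_of_injective _ hf]; simp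
  have hcardg : (Finset.univ.image g).card = 7 := by
    rw [Finset.card_image_of_injective _ hg]; simp
  have hinter : Finset.univ.image f ∩ Finset.univ.image g = A.image f := by
    ext x
    simp only [Finset.mem_inter, Finset.mem_image, Finset.mem_univ, true_and, hA,
      Finset.mem_filter]
    constructor
    · rintro ⟨⟨i, rfl⟩, j, hj⟩
      exact ⟨i, ⟨j, hj.symm⟩, rfl⟩
    · rintro ⟨i, ⟨j, hj⟩, rfl⟩
      exact ⟨⟨i, rfl⟩, j, hj.symm⟩
  have hS := Finset.card_union_add_card_inter (Finset.univ.image f) (Finset.univ.image g)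
  rw [hinter, Finset.card_image_of_injective _ hf, hcardf, hcardg] at hS
  have hE := Finset.card_union_add_card_inter (ddEdges f) (ddEdges g)
  rw [card_ddEdges hf, card_ddEdges hg] at hE
  have hsub : ddEdges f ∪ ddEdges g ⊆ edgesIn G (Finset.univ.image f ∪ Finset.univ.image g) := by
    intro e he
    refine Finset.mem_filter.2 ⟨?_, ?_⟩
    · rcases Finset.mem_union.1 he with he | he <;> obtain ⟨p, -, rfl⟩ := Finset.mem_image.1 he <;>
        simp
    · exact (Finset.mem_union.1 he).elim (ddEdges_subset_edgeSet f e) (ddEdges_subset_edgeSet g e)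
  have hsub := Finset.card_le_card hsub
  have hex := hG (Finset.univ.image f ∪ Finset.univ.image g) (by omega)
  have hb := card_ddEdges_inter_le f g (A := A) fun i j h => by
    simp only [hA, Finset.mem_filter, Finset.mem_univ, true_and]
    exact ⟨j, h⟩
  unfold excess at hex
  by_cases hAu : A = Finset.univ
  · have h7 : A.card = 7 := by rw [hAu]; simp
    have h9 : (ddEdges f ∩ ddEdges g).card ≠ 10 := by
      intro h10
      have h1 : ddEdges f ∩ ddEdges g = ddEdges f := Finset.eq_of_subset_of_card_le
        Finset.inter_subset_left (by rw [card_ddEdges hf, h10])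
      have h2 : ddEdges f ∩ ddEdges g = ddEdges g := Finset.eq_of_subset_of_card_le
        Finset.inter_subset_right (by rw [card_ddEdges hg, h10])
      have hv : Finset.univ.image f ∩ Finset.univ.image g = Finset.univ.image f := by
        rw [hinter, hAu]
      have hv' : Finset.univ.image f = Finset.univ.image g :=
        Finset.eq_of_subset_of_card_le (Finset.inter_eq_left.1 hv) (by rw [hcardf, hcardg])
      refine hne (SimpleGraph.Subgraph.ext ?_ ?_)
      · rw [toSubgraph_verts, toSubgraph_verts]
        have := congrArg (fun s : Finset V => (s : Set V)) hv'
        simpa using this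
      · ext a b
        rw [← mem_ddEdges_iff, ← mem_ddEdges_iff, ← h1, h2]
    have h10 : (ddEdges f ∩ ddEdges g).card ≤ 10 := by
      rw [← card_ddEdges hf]
      exact Finset.card_le_card Finset.inter_subset_left
    omega
  · have := card_ddPairsIn_lt A ⟨i, by
      simp only [hA, Finset.mem_filter, Finset.mem_univ, true_and]
      exact ⟨j, hij⟩⟩ hAu
    omega

lemma two_le_copyCount_iff [Fintype V] :
    2 ≤ G.copyCount doubleDiamond ↔
      ∃ f g : doubleDiamond.Copy G, f.toSubgraph ≠ g.toSubgraph := by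
  classical
  rw [SimpleGraph.copyCount_eq_card_image_copyToSubgraph]
  refine Finset.one_lt_card.trans ?_
  simp

end DoubleDiamond

/-! ### The winner on a sparse graph -/

section Winner

variable {V : Type} [DecidableEq V] [Fintype V] {G : SimpleGraph V}

lemma exists_pairing (hG : Sparse G) (hDD : ¬ doubleDiamond.IsContained G) :
    ∃ σ : V → V, (∀ x, σ (σ x) = x) ∧ ∀ M, HasTriangle G M → ContainsPair σ M := by
  obtain ⟨σ, hσ, hT⟩ := pairable_of_sparse hG hDD Finset.univ
  refine ⟨σ, hσ.invol, fun M hM => ?_⟩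
  obtain ⟨T, hTM, hc⟩ := (hasTriangle_iff G M).1 hM
  obtain ⟨x, hx, hx', hne⟩ := hT T (Finset.subset_univ _) hc
  exact ⟨x, hTM hx, hTM hx', hne⟩

theorem isMakerWin_maker_iff (hG : Sparse G) :
    IsMakerWin triangleGraph .maker G ↔ ContainsCopies 1 doubleDiamond G := by
  rw [ContainsCopies, Nat.succ_le_iff, SimpleGraph.copyCount_pos]
  constructor
  · intro h
    by_contra hDD
    obtain ⟨σ, hσ, hT⟩ := exists_pairing hG hDD
    exact not_makerWinsFrom_of_pairing (Wins := HasTriangle G) hσ (B₀ := ∅)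
      (fun M hM _ => hT M hM) (by simp) (by simp) (by simp) h
  · rintro ⟨f⟩
    exact makerWinsFrom_of_copy f (by simp)

theorem isMakerWin_breaker_iff (hG : Sparse G) :
    IsMakerWin triangleGraph .breaker G ↔ ContainsCopies 2 doubleDiamond G := by
  rw [ContainsCopies, two_le_copyCount_iff]
  constructor
  · intro h
    by_contra! hcop
    -- Breaker starts with a vertex whose deletion destroys all double diamonds.
    have hdel : ∀ v : V, ∃ x, ¬ doubleDiamond.IsContained (G.deleteIncidenceSet x) := by
      intro v
      by_contra! hall
      obtain ⟨f⟩ := hall v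
      obtain ⟨g⟩ := hall (f 0)
      have hle : ∀ x, G.deleteIncidenceSet x ≤ G := fun x => SimpleGraph.deleteIncidenceSet_le G x
      have heq := hcop ((SimpleGraph.Copy.ofLE _ _ (hle _)).comp f)
        ((SimpleGraph.Copy.ofLE _ _ (hle _)).comp g)
      have hv := congrArg SimpleGraph.Subgraph.verts heq
      rw [toSubgraph_verts, toSubgraph_verts] at hv
      obtain ⟨i, hi⟩ : f 0 ∈ Set.range ((SimpleGraph.Copy.ofLE _ _ (hle (f 0))).comp g) := by
        rw [← hv]
        exact ⟨0, rfl⟩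
      have hi : g i = f 0 := hi
      obtain ⟨j, hj⟩ : ∃ j, (i, j) ∈ ddPairs ∨ (j, i) ∈ ddPairs := by
        have hall : ∀ i : Fin 7, ∃ j, (i, j) ∈ ddPairs ∨ (j, i) ∈ ddPairs := by decide
        exact hall i
      have hadj := g.toHom.map_adj ((doubleDiamond_adj i j).2 hj)
      rw [SimpleGraph.deleteIncidenceSet_adj] at hadj
      exact hadj.2.1 hi
    cases h with
    | gameOver _ _ _ _ hwin =>
      obtain ⟨T, hT, hc⟩ := (hasTriangle_iff G ∅).1 hwin
      have := hc.card_eq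
      rw [Finset.subset_empty.1 hT] at this
      simp at this
    | breakerMove _ _ hexists hnext =>
      obtain ⟨v, -⟩ := hexists
      obtain ⟨x, hx⟩ := hdel v
      obtain ⟨σ, hσ, hT⟩ :=
        exists_pairing (hG.anti (SimpleGraph.deleteIncidenceSet_le G x)) hx
      refine not_makerWinsFrom_of_pairing (Wins := HasTriangle G) hσ (B₀ := {x})
        (fun M hM hdisj => hT M ?_) (B := {x}) (by simp) (by simp) (by simp)
        (hnext x (by simp))
      rw [hasTriangle_iff] at hM ⊢
      obtain ⟨T, hTM, hc⟩ := hM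
      rw [Finset.disjoint_singleton_right] at hdisj
      refine ⟨T, hTM, ?_, hc.2⟩
      intro a ha b hb hab
      rw [SimpleGraph.deleteIncidenceSet_adj]
      exact ⟨hc.1 ha hb hab, fun h => hdisj (h ▸ hTM ha), fun h => hdisj (h ▸ hTM hb)⟩
  · rintro ⟨f, g, hne⟩
    have hdisj := hG.disjoint_copies f g hne
    refine .breakerMove _ _ ⟨f 0, by simp⟩ fun v _ => ?_
    by_cases hv : ∃ i, f i = v
    · obtain ⟨i, rfl⟩ := hv
      exact makerWinsFrom_of_copy g fun j => by simpa using (hdisj i j).symm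
    · push Not at hv
      exact makerWinsFrom_of_copy f fun j => by simpa using hv j

end Winner

/-! ### Relative frequencies -/

section Freq

variable {Ω : Type*} [Fintype Ω]

open scoped Classical in
/-- The probability of the event `A` under the uniform distribution on `Ω`. -/
noncomputable def freq (A : Ω → Prop) : ℝ :=
  (Finset.univ.filter A).card / Fintype.card Ω

lemma freq_nonneg (A : Ω → Prop) : 0 ≤ freq A := by
  unfold freq
  positivity

lemma freq_eq (A : Ω → Prop) [DecidablePred A] :
    freq A = (Finset.univ.filter A).card / Fintype.card Ω := by
  unfold freq
  congr!

lemma freq_mono {A B : Ω → Prop} (h : ∀ ω, A ω → B ω) : freq A ≤ freq B := by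
  classical
  unfold freq
  gcongr with ω
  exact h ω

lemma freq_congr {A B : Ω → Prop} (h : ∀ ω, A ω ↔ B ω) : freq A = freq B :=
  le_antisymm (freq_mono fun ω => (h ω).1) (freq_mono fun ω => (h ω).2)

lemma freq_exists_le {ι : Type*} (s : Finset ι) (A : ι → Ω → Prop) :
    freq (fun ω => ∃ i ∈ s, A i ω) ≤ ∑ i ∈ s, freq (A i) := by
  classical
  unfold freq
  rw [← Finset.sum_div]
  gcongr
  rw [← Nat.cast_sum, Nat.cast_le]
  refine le_trans (Finset.card_le_card ?_) Finset.card_biUnion_le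
  intro ω hω
  simpa using hω

lemma freq_or_le (A B : Ω → Prop) : freq (fun ω => A ω ∨ B ω) ≤ freq A + freq B := by
  classical
  rw [freq_eq, freq_eq, freq_eq, ← add_div, ← Nat.cast_add]
  gcongr
  rw [Finset.filter_or]
  exact Finset.card_union_le _ _

lemma freq_add_freq_not [Nonempty Ω] (A : Ω → Prop) : freq A + freq (fun ω => ¬ A ω) = 1 := by
  classical
  have h : (Fintype.card Ω : ℝ) ≠ 0 := by exact_mod_cast Fintype.card_ne_zero
  unfold freq
  rw [← add_div, ← Nat.cast_add, Finset.card_filter_add_card_filter_not, Finset.card_univ,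
    div_self h]

lemma freq_eq_sum (A : Ω → Prop) [DecidablePred A] :
    freq A = (∑ ω, if A ω then (1 : ℝ) else 0) / Fintype.card Ω := by
  rw [freq_eq, Finset.sum_boole]

/-- The second moment method: Chebyshev's inequality for the number of events `A i` that occur. -/
lemma freq_count_le_one {ι : Type*} [Fintype ι] [Nonempty Ω] (A : ι → Ω → Prop)
    [∀ i, DecidablePred (A i)] (hμ : 1 < ∑ i, freq (A i)) :
    freq (fun ω => (Finset.univ.filter fun i => A i ω).card ≤ 1) * (∑ i, freq (A i) - 1) ^ 2 ≤
      ∑ i, ∑ j, (freq (fun ω => A i ω ∧ A j ω) - freq (A i) * freq (A j)) := by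
  set μ := ∑ i, freq (A i) with hμdef
  have hc : (0 : ℝ) < Fintype.card Ω := by exact_mod_cast Fintype.card_pos
  set X : Ω → ℝ := fun ω => ∑ i, if A i ω then (1 : ℝ) else 0 with hX
  have hXcard : ∀ ω, X ω = (Finset.univ.filter fun i => A i ω).card := fun ω => by
    simp only [hX, Finset.sum_boole]
  have h1 : (∑ ω, X ω) = μ * Fintype.card Ω := by
    rw [hX, Finset.sum_comm, hμdef, Finset.sum_mul]
    refine Finset.sum_congr rfl fun i _ => ?_
    rw [freq_eq_sum, div_mul_cancel₀ _ hc.ne']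
  have h2 : (∑ ω, X ω ^ 2) = (∑ i, ∑ j, freq (fun ω => A i ω ∧ A j ω)) * Fintype.card Ω := by
    have : ∀ ω, X ω ^ 2 = ∑ i, ∑ j, if A i ω ∧ A j ω then (1 : ℝ) else 0 := by
      intro ω
      rw [sq, hX, Finset.sum_mul_sum]
      refine Finset.sum_congr rfl fun i _ => Finset.sum_congr rfl fun j _ => ?_
      by_cases hi : A i ω <;> by_cases hj : A j ω <;> simp [hi, hj]
    simp_rw [this]
    rw [Finset.sum_comm, Finset.sum_mul]
    refine Finset.sum_congr rfl fun i _ => ?_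
    rw [Finset.sum_comm, Finset.sum_mul]
    refine Finset.sum_congr rfl fun j _ => ?_
    rw [freq_eq_sum, div_mul_cancel₀ _ hc.ne']
  have h3 : (∑ ω, (X ω - μ) ^ 2) =
      (∑ i, ∑ j, (freq (fun ω => A i ω ∧ A j ω) - freq (A i) * freq (A j))) *
        Fintype.card Ω := by
    have h4 : (∑ i, ∑ j, freq (A i) * freq (A j)) = μ ^ 2 := by
      rw [sq, hμdef, Finset.sum_mul_sum]
    have h5 : ∀ ω, (X ω - μ) ^ 2 = X ω ^ 2 - 2 * μ * X ω + μ ^ 2 := fun ω => by ring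
    simp_rw [h5, Finset.sum_sub_distrib, h4]
    rw [Finset.sum_add_distrib, Finset.sum_sub_distrib, h2, ← Finset.mul_sum, h1]
    simp only [Finset.sum_const, Finset.card_univ, nsmul_eq_mul]
    ring
  have h6 : ((Finset.univ.filter fun ω => (Finset.univ.filter fun i => A i ω).card ≤ 1).card : ℝ) *
      (μ - 1) ^ 2 ≤ ∑ ω, (X ω - μ) ^ 2 := by
    rw [← nsmul_eq_mul, ← Finset.sum_const]
    refine (Finset.sum_le_sum fun ω hω => ?_).trans
      (Finset.sum_le_sum_of_subset_of_nonneg (Finset.filter_subset _ _) fun _ _ _ => sq_nonneg _)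
    have hle : X ω ≤ 1 := by
      rw [hXcard]
      exact_mod_cast (Finset.mem_filter.1 hω).2
    nlinarith
  rw [h3] at h6
  rw [freq_eq, div_mul_eq_mul_div, div_le_iff₀ hc]
  exact h6

end Freq

/-! ### Sets of edges among the first edges of the process -/

section FallRatio

/-- The probability `N (N - 1) ⋯ (N - k + 1) / (m (m - 1) ⋯ (m - k + 1))` that `k` given elements
are among the first `N` in a uniformly random ordering of `m` elements. -/
noncomputable def fallRatio (N m k : ℕ) : ℝ :=
  ∏ j ∈ Finset.range k, ((N : ℝ) - j) / ((m : ℝ) - j)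

lemma fallRatio_nonneg {N m k : ℕ} (hk : k ≤ N) (hN : N ≤ m) : 0 ≤ fallRatio N m k := by
  refine Finset.prod_nonneg fun j hj => ?_
  have hj : j < k := Finset.mem_range.1 hj
  have h1 : (j : ℝ) ≤ N := by exact_mod_cast (hj.le.trans hk)
  have h2 : (N : ℝ) ≤ m := by exact_mod_cast hN
  exact div_nonneg (by linarith) (by linarith)

lemma fallRatio_le_pow {N m k : ℕ} (hk : k ≤ N) (hN : N ≤ m) :
    fallRatio N m k ≤ ((N : ℝ) / m) ^ k := by
  rw [← Finset.card_range k, ← Finset.prod_const]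
  rw [Finset.card_range]
  refine Finset.prod_le_prod (fun j hj => ?_) fun j hj => ?_
  all_goals
    have hj : j < k := Finset.mem_range.1 hj
    have h1 : (j : ℝ) < N := by exact_mod_cast (hj.trans_le hk)
    have h2 : (N : ℝ) ≤ m := by exact_mod_cast hN
  · exact div_nonneg (by linarith) (by linarith)
  · have h0 : (0 : ℝ) ≤ j := Nat.cast_nonneg j
    rw [div_le_div_iff₀ (by linarith) (by linarith)]
    nlinarith

lemma fallRatio_anti {N m k l : ℕ} (hkl : k ≤ l) (hl : l ≤ N) (hN : N ≤ m) :
    fallRatio N m l ≤ fallRatio N m k := by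
  obtain ⟨d, rfl⟩ := Nat.exists_eq_add_of_le hkl
  have hN' : (N : ℝ) ≤ m := by exact_mod_cast hN
  unfold fallRatio
  rw [Finset.prod_range_add]
  refine mul_le_of_le_one_right (fallRatio_nonneg (hkl.trans hl) hN)
    (Finset.prod_le_one (fun j hj => ?_) fun j hj => ?_)
  all_goals
    have hj : j < d := Finset.mem_range.1 hj
    have h1 : ((k + j : ℕ) : ℝ) < N := by exact_mod_cast (by omega)
  · exact div_nonneg (by linarith) (by linarith)
  · exact div_le_one_of_le₀ (by linarith) (by linarith)

/-- Disjoint sets of elements are negatively correlated. -/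
lemma fallRatio_add_le {N m k : ℕ} (hk : k + k ≤ N) (hN : N ≤ m) :
    fallRatio N m (k + k) ≤ fallRatio N m k ^ 2 := by
  have hN' : (N : ℝ) ≤ m := by exact_mod_cast hN
  have h0 := fallRatio_nonneg (N := N) (m := m) (k := k) (by omega) hN
  rw [sq]
  unfold fallRatio at *
  rw [Finset.prod_range_add]
  refine mul_le_mul_of_nonneg_left (Finset.prod_le_prod (fun j hj => ?_) fun j hj => ?_) h0
  all_goals
    have hj : j < k := Finset.mem_range.1 hj
    have h1 : ((k + j : ℕ) : ℝ) < N := by exact_mod_cast (by omega)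
    push_cast at *
  · exact div_nonneg (by linarith) (by linarith)
  · have hk0 : (0 : ℝ) ≤ k := Nat.cast_nonneg k
    rw [div_le_div_iff₀ (by linarith) (by linarith)]
    nlinarith

lemma le_fallRatio {N m k : ℕ} (hk : 2 * k ≤ N) (hN : N ≤ m) :
    ((N : ℝ) / m / 2) ^ k ≤ fallRatio N m k := by
  rw [← Finset.card_range k, ← Finset.prod_const]
  rw [Finset.card_range]
  refine Finset.prod_le_prod (fun j hj => by positivity) fun j hj => ?_
  have hj : j < k := Finset.mem_range.1 hj
  have h1 : 2 * (j : ℝ) < N := by exact_mod_cast (by omega)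
  have h2 : (N : ℝ) ≤ m := by exact_mod_cast hN
  have h0 : (0 : ℝ) ≤ j := Nat.cast_nonneg j
  rw [div_div, div_le_div_iff₀ (by linarith) (by linarith)]
  nlinarith

variable {α : Type*} [Fintype α] [DecidableEq α]

/-- In a uniformly random ordering of `m` elements, the set `E` is among the first `N` elements
with probability `fallRatio N m |E|`. -/
theorem freq_forall_lt {m N : ℕ} (hα : Fintype.card α = m) (hN : N ≤ m) (E : Finset α) :
    freq (fun π : Fin m ≃ α => ∀ e ∈ E, (π.symm e : ℕ) < N) = fallRatio N m E.card := by
  classical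
  have : Nonempty (Fin m ≃ α) := ⟨(Fintype.equivFinOfCardEq hα).symm⟩
  have hc : (Fintype.card (Fin m ≃ α) : ℝ) ≠ 0 := by exact_mod_cast Fintype.card_ne_zero
  induction E using Finset.induction_on with
  | empty =>
    simp only [Finset.notMem_empty, false_imp_iff, implies_true, Finset.card_empty]
    simp [freq, fallRatio, hc]
  | insert a E ha ih =>
    set A : Finset α → Finset (Fin m ≃ α) := fun E =>
      Finset.univ.filter fun π => ∀ e ∈ E, (π.symm e : ℕ) < N with hA
    -- By symmetry, adding any element outside `E` has the same effect.
    have hsymm : ∀ b ∈ Eᶜ, (A (insert b E)).card = (A (insert a E)).card := by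
      intro b hb
      rw [Finset.mem_compl] at hb
      refine Finset.card_equiv ((Equiv.refl (Fin m)).equivCongr (Equiv.swap a b)) fun π => ?_
      simp only [hA, Finset.mem_filter, Finset.mem_univ, true_and, Finset.forall_mem_insert]
      have hE : ∀ e ∈ E, Equiv.swap a b e = e := fun e he =>
        Equiv.swap_apply_of_ne_of_ne (fun h => ha (h ▸ he)) (fun h => hb (h ▸ he))
      refine and_congr (by simp [Equiv.equivCongr]) (forall₂_congr fun e he => ?_)
      simp [Equiv.equivCongr, hE e he]
    have hcount : ∑ b ∈ Eᶜ, (A (insert b E)).card = ∑ π ∈ A E, (N - E.card) := by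
      have h1 : ∀ b, (A (insert b E)).card = ∑ π ∈ A E, if (π.symm b : ℕ) < N then 1 else 0 := by
        intro b
        rw [← Finset.card_filter]
        congr 1
        ext π
        simp only [hA, Finset.mem_filter, Finset.mem_univ, true_and, Finset.forall_mem_insert]
        tauto
      simp_rw [h1]
      rw [Finset.sum_comm]
      refine Finset.sum_congr rfl fun π hπ => ?_
      rw [← Finset.card_filter]
      have hπ : ∀ e ∈ E, (π.symm e : ℕ) < N := by simpa [hA] using hπ
      have h2 : (Finset.univ.filter fun b => (π.symm b : ℕ) < N).card = N := by
        have : (Finset.univ.filter fun b => (π.symm b : ℕ) < N).card =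
            (Finset.univ.filter fun j : Fin m => (j : ℕ) < N).card :=
          Finset.card_equiv π.symm (by simp)
        rw [this]
        have := Fin.card_filter_val_lt (n := m) (m := N)
        simpa [hN] using this
      have h3 : (Eᶜ.filter fun b => (π.symm b : ℕ) < N) =
          (Finset.univ.filter fun b => (π.symm b : ℕ) < N) \ E := by
        ext b
        simp [and_comm]
      rw [h3, Finset.card_sdiff_of_subset (fun e he => by simpa using hπ e he), h2]
    rw [Finset.sum_congr rfl hsymm, Finset.sum_const, Finset.sum_const, smul_eq_mul, smul_eq_mul,
      Finset.card_compl, hα] at hcount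
    have hEm : E.card < m := by
      rw [← hα]
      exact Finset.card_lt_univ_of_notMem ha
    have hcount' : ((m : ℝ) - E.card) * (A (insert a E)).card =
        (A E).card * ((N : ℝ) - E.card) := by
      by_cases hEN : E.card ≤ N
      · have := congrArg (Nat.cast (R := ℝ)) hcount
        push_cast [Nat.cast_sub hEm.le, Nat.cast_sub hEN] at this
        exact this
      · -- More than `N` elements cannot all be among the first `N`.
        have h0 : (A E).card = 0 := by
          rw [Finset.card_eq_zero, Finset.eq_empty_iff_forall_notMem]
          intro π hπ
          have hπ : ∀ e ∈ E, (π.symm e : ℕ) < N := by simpa [hA] using hπ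
          have := Finset.card_le_card_of_injOn (s := E) (t := Finset.range N)
            (fun e => (π.symm e : ℕ)) (fun e he => by simpa using hπ e he)
            (fun x _ y _ h => π.symm.injective (Fin.ext h))
          rw [Finset.card_range] at this
          exact hEN this
        have h1 : (A (insert a E)).card = 0 := by
          rw [h0, zero_mul, Nat.mul_eq_zero] at hcount
          omega
        rw [h0, h1]
        simp
    have hpos : (0 : ℝ) < (m : ℝ) - E.card := by
      rw [sub_pos]
      exact_mod_cast hEm
    have hfr : ∀ E, freq (fun π : Fin m ≃ α => ∀ e ∈ E, (π.symm e : ℕ) < N) =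
        (A E).card / Fintype.card (Fin m ≃ α) := fun E => by
      simp only [freq, hA]
      congr!
    rw [Finset.card_insert_of_notMem ha, fallRatio, Finset.prod_range_succ, ← fallRatio, ← ih,
      hfr, hfr, div_mul_div_comm, div_eq_div_iff hc (mul_ne_zero hc hpos.ne')]
    linear_combination (Fintype.card (Fin m ≃ α) : ℝ) * hcount'

end FallRatio

section EdgeEvents

variable {n : ℕ}

lemma card_edgeSet_top (n : ℕ) :
    Fintype.card (⊤ : SimpleGraph (Fin n)).edgeSet = n.choose 2 := by
  rw [← SimpleGraph.edgeFinset_card]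
  simpa using SimpleGraph.card_edgeFinset_top_eq_card_choose_two (V := Fin n)

lemma mem_edgeSet_graphProcess (π : EdgeOrdering n) (N : ℕ)
    (e : (⊤ : SimpleGraph (Fin n)).edgeSet) :
    (e : Sym2 (Fin n)) ∈ (graphProcess π N).edgeSet ↔ (π.symm e : ℕ) < N := by
  rw [graphProcess, SimpleGraph.edgeSet_fromEdgeSet]
  constructor
  · rintro ⟨⟨j, hj, hje⟩, -⟩
    have : π j = e := Subtype.ext hje
    rwa [← this, Equiv.symm_apply_apply]
  · intro h
    refine ⟨⟨π.symm e, h, by simp⟩, ?_⟩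
    have := (⊤ : SimpleGraph (Fin n)).not_isDiag_of_mem_edgeSet e.2
    simpa using this

lemma graphProcess_mono (π : EdgeOrdering n) {i N : ℕ} (h : i ≤ N) :
    graphProcess π i ≤ graphProcess π N := by
  refine SimpleGraph.fromEdgeSet_mono ?_
  rintro e ⟨j, hj, he⟩
  exact ⟨j, hj.trans_le h, he⟩

/-- The probability that the edges in `E` are among the first `N` edges of the process. -/
lemma freq_forall_mem_edgeSet {N : ℕ} (hN : N ≤ n.choose 2) (E : Finset (Sym2 (Fin n)))
    (hE : ∀ e ∈ E, ¬ e.IsDiag) :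
    freq (fun π : EdgeOrdering n => ∀ e ∈ E, e ∈ (graphProcess π N).edgeSet) =
      fallRatio N (n.choose 2) E.card := by
  classical
  have htop : ∀ e ∈ E, e ∈ (⊤ : SimpleGraph (Fin n)).edgeSet := fun e he => by
    simpa [SimpleGraph.edgeSet_top] using hE e he
  have hcard : (E.subtype (· ∈ (⊤ : SimpleGraph (Fin n)).edgeSet)).card = E.card := by
    rw [Finset.card_subtype, Finset.filter_true_of_mem htop]
  rw [← hcard]
  refine (freq_congr fun π => ?_).trans (freq_forall_lt (card_edgeSet_top n) hN _)
  constructor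
  · intro h e he
    exact (mem_edgeSet_graphProcess π N e).1 (h e (Finset.mem_subtype.1 he))
  · intro h e he
    exact (mem_edgeSet_graphProcess π N ⟨e, htop e he⟩).2
      (h ⟨e, htop e he⟩ (Finset.mem_subtype.2 he))

/-- The least number of edges that makes the excess of a set of `k` vertices negative. -/
def denseCount (k : ℕ) : ℕ := 10 * k / 7 + 1

lemma denseCount_le {k : ℕ} (hk : k ≤ 30) : denseCount k ≤ 43 := by
  unfold denseCount
  omega

/-- First moment bound for the existence of a small dense set of vertices. -/
lemma freq_not_sparse_le {N : ℕ} (hN : N ≤ n.choose 2) (h43 : 43 ≤ N) :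
    freq (fun π : EdgeOrdering n => ¬ Sparse (graphProcess π N)) ≤
      ∑ k ∈ Finset.range 31, ((k + 1).choose 2).choose (denseCount k) *
        ((n : ℝ) ^ k * ((N : ℝ) / n.choose 2) ^ denseCount k) := by
  classical
  set D : Finset (Fin n) → Finset (Sym2 (Fin n)) := fun S => S.sym2.filter fun e => ¬ e.IsDiag
    with hD
  have h1 : freq (fun π : EdgeOrdering n => ¬ Sparse (graphProcess π N)) ≤
      freq (fun π : EdgeOrdering n => ∃ k ∈ Finset.range 31,
        ∃ S ∈ Finset.powersetCard k (Finset.univ : Finset (Fin n)),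
        ∃ E ∈ Finset.powersetCard (denseCount k) (D S),
          ∀ e ∈ E, e ∈ (graphProcess π N).edgeSet) := by
    refine freq_mono fun π hπ => ?_
    unfold Sparse at hπ
    push Not at hπ
    obtain ⟨S, hS, hneg⟩ := hπ
    unfold excess at hneg
    obtain ⟨E, hE, hEc⟩ := Finset.exists_subset_card_eq (s := edgesIn (graphProcess π N) S)
      (n := denseCount S.card) (by unfold denseCount; omega)
    refine ⟨S.card, Finset.mem_range.2 (by omega), S,
      Finset.mem_powersetCard.2 ⟨Finset.subset_univ _, rfl⟩, E,
      Finset.mem_powersetCard.2 ⟨fun e he => ?_, hEc⟩, fun e he => ?_⟩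
    · have := Finset.mem_filter.1 (hE he)
      exact Finset.mem_filter.2 ⟨this.1, SimpleGraph.not_isDiag_of_mem_edgeSet _ this.2⟩
    · exact (Finset.mem_filter.1 (hE he)).2
  refine h1.trans ((freq_exists_le _ _).trans (Finset.sum_le_sum fun k hk => ?_))
  have hk : k ≤ 30 := by
    have := Finset.mem_range.1 hk
    omega
  have hdk := denseCount_le hk
  set p : ℝ := (N : ℝ) / n.choose 2 with hp
  have hp0 : 0 ≤ p := by positivity
  have h2 : ∀ S ∈ Finset.powersetCard k (Finset.univ : Finset (Fin n)),
      freq (fun π : EdgeOrdering n => ∃ E ∈ Finset.powersetCard (denseCount k) (D S),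
          ∀ e ∈ E, e ∈ (graphProcess π N).edgeSet) ≤
        ((k + 1).choose 2).choose (denseCount k) * p ^ denseCount k := by
    intro S hS
    refine (freq_exists_le _ _).trans ?_
    have h3 : ∀ E ∈ Finset.powersetCard (denseCount k) (D S),
        freq (fun π : EdgeOrdering n => ∀ e ∈ E, e ∈ (graphProcess π N).edgeSet) ≤
          p ^ denseCount k := by
      intro E hE
      obtain ⟨hE1, hE2⟩ := Finset.mem_powersetCard.1 hE
      rw [freq_forall_mem_edgeSet hN E (fun e he => (Finset.mem_filter.1 (hE1 he)).2), hE2]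
      exact fallRatio_le_pow (by omega) hN
    refine (Finset.sum_le_card_nsmul _ _ _ h3).trans ?_
    rw [nsmul_eq_mul, Finset.card_powersetCard]
    refine mul_le_mul_of_nonneg_right ?_ (by positivity)
    rw [Nat.cast_le]
    refine Nat.choose_le_choose _ ((Finset.card_filter_le _ _).trans ?_)
    rw [Finset.card_sym2, (Finset.mem_powersetCard.1 hS).2]
  refine (freq_exists_le _ _).trans ((Finset.sum_le_card_nsmul _ _ _ h2).trans ?_)
  rw [nsmul_eq_mul, Finset.card_powersetCard, Finset.card_univ, Fintype.card_fin]
  have h4 : (n.choose k : ℝ) ≤ (n : ℝ) ^ k := by exact_mod_cast Nat.choose_le_pow n k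
  calc (n.choose k : ℝ) * (((k + 1).choose 2).choose (denseCount k) * p ^ denseCount k)
      ≤ (n : ℝ) ^ k * (((k + 1).choose 2).choose (denseCount k) * p ^ denseCount k) := by gcongr
    _ = _ := by ring

end EdgeEvents

/-! ### Double diamonds across a partition of the vertices -/

section Transversal

variable {n L : ℕ}

/-- The vertices `0, …, 7 L - 1` are split into seven intervals of length `L`; the map sends `i`
to the element `g i` of the `i`-th interval. -/
def transversal (hL : 7 * L ≤ n) (g : Fin 7 → Fin L) (i : Fin 7) : Fin n :=
  ⟨i * L + g i, by
    have h1 : (i : ℕ) * L ≤ 6 * L := Nat.mul_le_mul_right _ (by omega)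
    have h2 := (g i).2
    omega⟩

lemma transversal_inj (hL : 7 * L ≤ n) {g g' : Fin 7 → Fin L} {i j : Fin 7}
    (h : transversal hL g i = transversal hL g' j) : i = j ∧ g i = g' i := by
  have hL0 : 0 < L := (Nat.zero_le _).trans_lt (g 0).2
  have h : (i : ℕ) * L + g i = j * L + g' j := congrArg Fin.val h
  have hij : i = j := by
    have h1 : ((i : ℕ) * L + g i) / L = i := by
      rw [mul_comm, Nat.mul_add_div hL0, Nat.div_eq_of_lt (g i).2, add_zero]
    have h2 : ((j : ℕ) * L + g' j) / L = j := by
      rw [mul_comm, Nat.mul_add_div hL0, Nat.div_eq_of_lt (g' j).2, add_zero]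
    exact Fin.ext (by rw [← h1, h, h2])
  subst hij
  exact ⟨rfl, Fin.ext (by omega)⟩

lemma transversal_injective (hL : 7 * L ≤ n) (g : Fin 7 → Fin L) :
    Function.Injective (transversal hL g) :=
  fun _ _ h => (transversal_inj hL h).1

/-- The positions where `g` and `g'` agree. -/
def agreeSet (g g' : Fin 7 → Fin L) : Finset (Fin 7) :=
  Finset.univ.filter fun i => g i = g' i

lemma card_transversal_inter_le (hL : 7 * L ≤ n) (g g' : Fin 7 → Fin L) :
    (ddEdges (transversal hL g) ∩ ddEdges (transversal hL g')).card ≤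
      (ddPairsIn (agreeSet g g')).card :=
  card_ddEdges_inter_le _ _ fun i j h => by
    simpa [agreeSet] using (transversal_inj hL h).2

lemma not_isDiag_of_mem_ddEdges {V : Type*} [DecidableEq V] {f : Fin 7 → V}
    (hf : Function.Injective f) : ∀ e ∈ ddEdges f, ¬ e.IsDiag := by
  intro e he
  obtain ⟨p, hp, rfl⟩ := Finset.mem_image.1 he
  rw [Sym2.mk_isDiag_iff]
  exact fun h => (lt_of_mem_ddPairs p hp).ne (hf h)

/-- The copy of the double diamond with vertex map `f`, if its edges are in `G`. -/
def copyOfEdges {V : Type*} [DecidableEq V] {G : SimpleGraph V} {f : Fin 7 → V}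
    (hf : Function.Injective f) (h : ∀ e ∈ ddEdges f, e ∈ G.edgeSet) : doubleDiamond.Copy G :=
  ⟨⟨f, fun {i j} hij => by
    rcases (doubleDiamond_adj i j).1 hij with hp | hp
    · exact h s(f i, f j) (Finset.mem_image.2 ⟨_, hp, rfl⟩)
    · exact (h s(f j, f i) (Finset.mem_image.2 ⟨_, hp, rfl⟩)).symm⟩, hf⟩

open scoped Classical in
lemma card_le_one_of_not_containsCopies (hL : 7 * L ≤ n) {G : SimpleGraph (Fin n)}
    (hG : ¬ ContainsCopies 2 doubleDiamond G) :
    (Finset.univ.filter fun g : Fin 7 → Fin L =>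
      ∀ e ∈ ddEdges (transversal hL g), e ∈ G.edgeSet).card ≤ 1 := by
  rw [ContainsCopies, two_le_copyCount_iff] at hG
  push Not at hG
  refine Finset.card_le_one.2 fun g hg g' hg' => ?_
  have heq := hG (copyOfEdges (transversal_injective hL g) (Finset.mem_filter.1 hg).2)
    (copyOfEdges (transversal_injective hL g') (Finset.mem_filter.1 hg').2)
  have hv := congrArg SimpleGraph.Subgraph.verts heq
  rw [toSubgraph_verts, toSubgraph_verts] at hv
  have hv : Set.range (transversal hL g) = Set.range (transversal hL g') := hv
  funext i
  obtain ⟨j, hj⟩ : transversal hL g i ∈ Set.range (transversal hL g') := hv ▸ ⟨i, rfl⟩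
  exact (transversal_inj hL hj.symm).2

lemma card_agree (A : Finset (Fin 7)) (g : Fin 7 → Fin L) :
    (Finset.univ.filter fun g' : Fin 7 → Fin L => ∀ i ∈ A, g i = g' i).card =
      L ^ (7 - A.card) := by
  have : (Finset.univ.filter fun g' : Fin 7 → Fin L => ∀ i ∈ A, g i = g' i) =
      Fintype.piFinset fun i => if i ∈ A then {g i} else Finset.univ := by
    ext g'
    simp only [Finset.mem_filter, Finset.mem_univ, true_and, Fintype.mem_piFinset]
    refine forall_congr' fun i => ?_
    by_cases hi : i ∈ A <;> simp [hi, eq_comm]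
  rw [this, Fintype.card_piFinset]
  have h : ∀ i, (if i ∈ A then {g i} else (Finset.univ : Finset (Fin L))).card =
      if i ∈ A then 1 else L := fun i => by
    split_ifs <;> simp
  simp_rw [h]
  rw [Finset.prod_ite, Finset.prod_const_one, one_mul, Finset.prod_const]
  congr 1
  rw [Finset.filter_not, Finset.card_sdiff_of_subset (Finset.filter_subset _ _)]
  simp

/-- A sum over pairs of functions of a term that depends on the set where they agree. -/
lemma sum_agreeSet_le (F : Finset (Fin 7) → ℝ) (hF : ∀ A, 0 ≤ F A) :
    ∑ g : Fin 7 → Fin L, ∑ g' : Fin 7 → Fin L, F (agreeSet g g') ≤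
      ∑ A, (L : ℝ) ^ 7 * (L : ℝ) ^ (7 - A.card) * F A := by
  have h1 : ∀ g g' : Fin 7 → Fin L,
      F (agreeSet g g') ≤ ∑ A, if ∀ i ∈ A, g i = g' i then F A else 0 := by
    intro g g'
    refine le_trans ?_ (Finset.single_le_sum (f := fun A => if ∀ i ∈ A, g i = g' i then F A else 0)
      (fun A _ => ?_) (Finset.mem_univ (agreeSet g g')))
    · simp [agreeSet]
    · split_ifs
      exacts [hF A, le_rfl]
  calc ∑ g : Fin 7 → Fin L, ∑ g' : Fin 7 → Fin L, F (agreeSet g g')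
      ≤ ∑ g : Fin 7 → Fin L, ∑ g' : Fin 7 → Fin L,
          ∑ A, (if ∀ i ∈ A, g i = g' i then F A else 0) :=
        Finset.sum_le_sum fun g _ => Finset.sum_le_sum fun g' _ => h1 g g'
    _ = ∑ g : Fin 7 → Fin L, ∑ A, (L : ℝ) ^ (7 - A.card) * F A := by
        refine Finset.sum_congr rfl fun g _ => ?_
        rw [Finset.sum_comm]
        refine Finset.sum_congr rfl fun A _ => ?_
        rw [← Finset.sum_filter, Finset.sum_const, card_agree, nsmul_eq_mul, Nat.cast_pow]
    _ = _ := by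
        rw [Finset.sum_const, Finset.card_univ, Fintype.card_fun, Fintype.card_fin,
          Fintype.card_fin, nsmul_eq_mul, Finset.mul_sum]
        refine Finset.sum_congr rfl fun A _ => ?_
        push_cast
        ring

/-- The event that the transversal double diamond given by `g` is present after `N` steps. -/
def TransversalEvent (hL : 7 * L ≤ n) (N : ℕ) (g : Fin 7 → Fin L) (π : EdgeOrdering n) : Prop :=
  ∀ e ∈ ddEdges (transversal hL g), e ∈ (graphProcess π N).edgeSet

lemma freq_transversalEvent (hL : 7 * L ≤ n) {N : ℕ} (hN : N ≤ n.choose 2)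
    (g : Fin 7 → Fin L) : freq (TransversalEvent hL N g) = fallRatio N (n.choose 2) 10 := by
  rw [← card_ddEdges (transversal_injective hL g)]
  exact freq_forall_mem_edgeSet hN _ (not_isDiag_of_mem_ddEdges (transversal_injective hL g))

/-- A bound for the covariance of two transversal double diamonds: copies without common edges are
negatively correlated. -/
lemma freq_transversal_pair_le (hL : 7 * L ≤ n) {N : ℕ} (hN : N ≤ n.choose 2) (h20 : 20 ≤ N)
    (g g' : Fin 7 → Fin L) :
    freq (fun π => TransversalEvent hL N g π ∧ TransversalEvent hL N g' π) -
        freq (TransversalEvent hL N g) * freq (TransversalEvent hL N g') ≤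
      if ddPairsIn (agreeSet g g') ≠ ∅ then
        ((N : ℝ) / n.choose 2) ^ (20 - (ddPairsIn (agreeSet g g')).card) else 0 := by
  have hg := transversal_injective hL g
  have hg' := transversal_injective hL g'
  have h1 : freq (fun π => TransversalEvent hL N g π ∧ TransversalEvent hL N g' π) =
      fallRatio N (n.choose 2)
        (ddEdges (transversal hL g) ∪ ddEdges (transversal hL g')).card := by
    rw [← freq_forall_mem_edgeSet hN _ fun e he => (Finset.mem_union.1 he).elim
      (not_isDiag_of_mem_ddEdges hg e) (not_isDiag_of_mem_ddEdges hg' e)]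
    exact freq_congr fun π => Finset.forall_mem_union.symm
  have h2 := Finset.card_union_add_card_inter (ddEdges (transversal hL g))
    (ddEdges (transversal hL g'))
  rw [card_ddEdges hg, card_ddEdges hg'] at h2
  have h3 := card_transversal_inter_le hL g g'
  rw [h1, freq_transversalEvent hL hN, freq_transversalEvent hL hN, ← sq]
  split_ifs with hA
  · have h4 := card_ddPairsIn_le_ten (agreeSet g g')
    exact (sub_le_self _ (sq_nonneg _)).trans <|
      (fallRatio_anti (by omega) (by omega) hN).trans (fallRatio_le_pow (by omega) hN)
  · rw [not_not] at hA
    rw [hA, Finset.card_empty] at h3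
    have h4 : (ddEdges (transversal hL g) ∪ ddEdges (transversal hL g')).card = 10 + 10 := by
      omega
    have h5 := fallRatio_add_le (N := N) (m := n.choose 2) (k := 10) (by omega) hN
    rw [h4]
    linarith

/-- Second moment bound for the appearance of two double diamonds. -/
lemma freq_not_containsCopies_le (hL : 7 * L ≤ n) {N : ℕ} (hN : N ≤ n.choose 2) (h20 : 20 ≤ N)
    (hμ : 2 ^ 11 ≤ (L : ℝ) ^ 7 * ((N : ℝ) / n.choose 2) ^ 10) :
    freq (fun π : EdgeOrdering n => ¬ ContainsCopies 2 doubleDiamond (graphProcess π N)) ≤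
      2 ^ 22 * ∑ A with ddPairsIn A ≠ ∅,
        ((L : ℝ) ^ A.card * ((N : ℝ) / n.choose 2) ^ (ddPairsIn A).card)⁻¹ := by
  classical
  set m := n.choose 2 with hm
  set p : ℝ := (N : ℝ) / m with hp
  have hm0 : (0 : ℝ) < m := by exact_mod_cast (by omega)
  have hp0 : 0 < p := div_pos (by exact_mod_cast (by omega)) hm0
  have hL0 : (0 : ℝ) < L := by
    rcases Nat.eq_zero_or_pos L with h | h
    · norm_num [h] at hμ
    · exact_mod_cast h
  set Ev : (Fin 7 → Fin L) → EdgeOrdering n → Prop := TransversalEvent hL N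
  have hfreq : ∀ g, freq (Ev g) = fallRatio N m 10 := freq_transversalEvent hL hN
  have hsum : ∑ g, freq (Ev g) = (L : ℝ) ^ 7 * fallRatio N m 10 := by
    simp_rw [hfreq]
    rw [Finset.sum_const, Finset.card_univ, Fintype.card_fun, Fintype.card_fin,
      Fintype.card_fin, nsmul_eq_mul]
    push_cast
    ring
  have hr : (p / 2) ^ 10 ≤ fallRatio N m 10 := le_fallRatio (by omega) hN
  have hμ' : (L : ℝ) ^ 7 * p ^ 10 / 2 ^ 10 ≤ ∑ g, freq (Ev g) := by
    rw [hsum]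
    calc (L : ℝ) ^ 7 * p ^ 10 / 2 ^ 10 = (L : ℝ) ^ 7 * (p / 2) ^ 10 := by ring
      _ ≤ _ := by gcongr
  have hμ2 : 2 ≤ (L : ℝ) ^ 7 * p ^ 10 / 2 ^ 10 := by linarith
  set F : Finset (Fin 7) → ℝ := fun A =>
    if ddPairsIn A ≠ ∅ then p ^ (20 - (ddPairsIn A).card) else 0 with hF
  have hpair : ∀ g g', freq (fun π => Ev g π ∧ Ev g' π) - freq (Ev g) * freq (Ev g') ≤
      F (agreeSet g g') := fun g g' =>
    freq_transversal_pair_le hL hN h20 g g'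
  have hcheb := freq_count_le_one Ev (by linarith)
  have hvar : ∑ g, ∑ g', (freq (fun π => Ev g π ∧ Ev g' π) - freq (Ev g) * freq (Ev g')) ≤
      ∑ A, (L : ℝ) ^ 7 * (L : ℝ) ^ (7 - A.card) * F A :=
    (Finset.sum_le_sum fun g _ => Finset.sum_le_sum fun g' _ => hpair g g').trans
      (sum_agreeSet_le F fun A => by
        simp only [hF]
        split_ifs <;> positivity)
  have hle : freq (fun π : EdgeOrdering n => ¬ ContainsCopies 2 doubleDiamond (graphProcess π N))
      ≤ freq (fun π => (Finset.univ.filter fun g => Ev g π).card ≤ 1) :=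
    freq_mono fun π hπ => by
      have := card_le_one_of_not_containsCopies hL hπ
      unfold Ev TransversalEvent
      convert! this
  set M : ℝ := (L : ℝ) ^ 7 * p ^ 10 with hM
  have hM0 : 0 < M := by positivity
  -- The mean is at least `M / 2 ^ 10`, and hence exceeds `1` by at least `M / 2 ^ 11`.
  have hsq : M ^ 2 / 2 ^ 22 ≤ (∑ g, freq (Ev g) - 1) ^ 2 := by
    have h1 : M / 2 ^ 11 ≤ ∑ g, freq (Ev g) - 1 := by linarith
    calc M ^ 2 / 2 ^ 22 = (M / 2 ^ 11) ^ 2 := by ring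
      _ ≤ _ := by gcongr
  have hq0 := freq_nonneg (fun π => (Finset.univ.filter fun g => Ev g π).card ≤ 1)
  have h1 : freq (fun π => (Finset.univ.filter fun g => Ev g π).card ≤ 1) * (M ^ 2 / 2 ^ 22) ≤
      ∑ A, (L : ℝ) ^ 7 * (L : ℝ) ^ (7 - A.card) * F A :=
    (mul_le_mul_of_nonneg_left hsq hq0).trans (hcheb.trans hvar)
  refine hle.trans ?_
  rw [← le_div_iff₀ (by positivity)] at h1
  refine h1.trans (le_of_eq ?_)
  rw [Finset.sum_div, Finset.mul_sum, Finset.sum_filter]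
  refine Finset.sum_congr rfl fun A _ => ?_
  simp only [hF]
  split_ifs with hA
  · have hA7 : A.card ≤ 7 := by simpa using Finset.card_le_univ A
    have e1 : (L : ℝ) ^ 7 = (L : ℝ) ^ (7 - A.card) * (L : ℝ) ^ A.card := by
      rw [← pow_add]
      congr 1
      omega
    have e2 : p ^ 20 = p ^ (20 - (ddPairsIn A).card) * p ^ (ddPairsIn A).card := by
      rw [← pow_add]
      congr 1
      have := card_ddPairsIn_le_ten A
      omega
    have e3 : M ^ 2 = (L : ℝ) ^ 7 * ((L : ℝ) ^ (7 - A.card) * (L : ℝ) ^ A.card) *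
        (p ^ (20 - (ddPairsIn A).card) * p ^ (ddPairsIn A).card) := by
      rw [← e1, ← e2, hM]
      ring
    rw [e3]
    field_simp
  · simp

end Transversal

/-! ### Asymptotics -/

section Asymptotics

/-- The edge density `n ^ (-699/1000)`, slightly above the threshold `n ^ (-7/10)` for the
appearance of double diamonds. The surplus `1/1000` in the exponent is so small that the at most `43`
edges of a small dense set gain less than the factor `n ^ (1/10)` which such a set lacks. -/
noncomputable def density (n : ℕ) : ℝ := (n : ℝ) ^ (-(699 / 1000) : ℝ)

/-- The number of steps after which the random graph is compared with the two properties. -/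
noncomputable def stepCount (n : ℕ) : ℕ := ⌊(n.choose 2 : ℝ) * density n⌋₊

lemma density_pos {n : ℕ} (hn : 0 < n) : 0 < density n :=
  Real.rpow_pos_of_pos (by exact_mod_cast hn) _

lemma pow_mul_density_pow {n : ℕ} (hn : 0 < n) (k e : ℕ) :
    (n : ℝ) ^ k * density n ^ e = (n : ℝ) ^ ((k : ℝ) - 699 / 1000 * e) := by
  have h : (0 : ℝ) < n := by exact_mod_cast hn
  rw [density, ← Real.rpow_natCast, ← Real.rpow_natCast, ← Real.rpow_mul h.le,
    ← Real.rpow_add h]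
  congr 1
  ring

lemma tendsto_pow_mul_density_zero {k e : ℕ} (h : 1000 * k < 699 * e) :
    Tendsto (fun n : ℕ => (n : ℝ) ^ k * density n ^ e) atTop (𝓝 0) := by
  have hpos : (0 : ℝ) < 699 / 1000 * e - k := by
    have : (1000 : ℝ) * k < 699 * e := by exact_mod_cast h
    linarith
  refine ((tendsto_rpow_neg_atTop hpos).comp tendsto_natCast_atTop_atTop).congr' ?_
  filter_upwards [eventually_gt_atTop 0] with n hn
  rw [pow_mul_density_pow hn, Function.comp_apply, neg_sub]

lemma tendsto_pow_mul_density_atTop {k e : ℕ} (h : 699 * e < 1000 * k) :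
    Tendsto (fun n : ℕ => (n : ℝ) ^ k * density n ^ e) atTop atTop := by
  have hpos : (0 : ℝ) < k - 699 / 1000 * e := by
    have : (699 : ℝ) * e < 1000 * k := by exact_mod_cast h
    linarith
  refine ((tendsto_rpow_atTop hpos).comp tendsto_natCast_atTop_atTop).congr' ?_
  filter_upwards [eventually_gt_atTop 0] with n hn
  rw [pow_mul_density_pow hn, Function.comp_apply]

lemma stepCount_le {n : ℕ} (hn : 0 < n) : stepCount n ≤ n.choose 2 := by
  refine Nat.floor_le_of_le (mul_le_of_le_one_right (Nat.cast_nonneg _) ?_)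
  exact Real.rpow_le_one_of_one_le_of_nonpos (by exact_mod_cast hn) (by norm_num)

lemma stepCount_div_le {n : ℕ} (hn : 0 < n) :
    (stepCount n : ℝ) / n.choose 2 ≤ density n := by
  have hd := density_pos hn
  refine div_le_of_le_mul₀ (Nat.cast_nonneg _) hd.le ?_
  rw [mul_comm]
  exact Nat.floor_le (by positivity)

lemma eventually_stepCount :
    ∀ᶠ n : ℕ in atTop, 43 ≤ stepCount n ∧ density n / 2 ≤ (stepCount n : ℝ) / n.choose 2 := by
  have h := (tendsto_pow_mul_density_atTop (k := 2) (e := 1) (by norm_num)).eventually_ge_atTop 176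
  filter_upwards [h, eventually_ge_atTop 2] with n hn hn2
  have hd := density_pos (n := n) (by omega)
  have hn2' : (2 : ℝ) ≤ n := by exact_mod_cast hn2
  have hm : (n : ℝ) ^ 2 / 4 ≤ (n.choose 2 : ℝ) := by
    rw [Nat.cast_choose_two]
    nlinarith
  have hmy : 44 ≤ (n.choose 2 : ℝ) * density n := by
    rw [pow_one] at hn
    nlinarith
  have hfl := Nat.lt_floor_add_one ((n.choose 2 : ℝ) * density n)
  change _ < (stepCount n : ℝ) + 1 at hfl
  constructor
  · have h43 : (43 : ℝ) < (stepCount n : ℝ) + 1 := by linarith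
    have h43' : 43 < stepCount n + 1 := by exact_mod_cast h43
    omega
  · have hm0 : (0 : ℝ) < n.choose 2 := lt_of_lt_of_le (by positivity) hm
    rw [le_div_iff₀ hm0]
    nlinarith

lemma sparse_whp :
    Tendsto (fun n : ℕ => freq fun π : EdgeOrdering n => ¬ Sparse (graphProcess π (stepCount n)))
      atTop (𝓝 0) := by
  have hlim : Tendsto (fun n : ℕ => ∑ k ∈ Finset.range 31,
      (((k + 1).choose 2).choose (denseCount k) : ℝ) * ((n : ℝ) ^ k * density n ^ denseCount k))
      atTop (𝓝 0) := by
    rw [← Finset.sum_const_zero (s := Finset.range 31)]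
    refine tendsto_finsetSum _ fun k hk => ?_
    rw [← mul_zero ((((k + 1).choose 2).choose (denseCount k) : ℕ) : ℝ)]
    refine (tendsto_pow_mul_density_zero ?_).const_mul _
    have := Finset.mem_range.1 hk
    unfold denseCount
    omega
  refine squeeze_zero' (.of_forall fun n => freq_nonneg _) ?_ hlim
  filter_upwards [eventually_stepCount, eventually_gt_atTop 0] with n hn hn0
  refine (freq_not_sparse_le (stepCount_le hn0) hn.1).trans
    (Finset.sum_le_sum fun k _ => ?_)
  have := stepCount_div_le hn0
  gcongr

lemma containsCopies_whp :
    Tendsto (fun n : ℕ => freq fun π : EdgeOrdering n =>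
      ¬ ContainsCopies 2 doubleDiamond (graphProcess π (stepCount n))) atTop (𝓝 0) := by
  have hatTop : ∀ a b : ℕ, 699 * b < 1000 * a →
      Tendsto (fun n : ℕ => ((n : ℝ) / 14) ^ a * (density n / 2) ^ b) atTop atTop := by
    intro a b hab
    have h := (tendsto_pow_mul_density_atTop hab).const_mul_atTop
      (r := ((14 : ℝ) ^ a * 2 ^ b)⁻¹) (by positivity)
    refine h.congr fun n => ?_
    rw [div_pow, div_pow]
    field_simp
  have hlim : Tendsto (fun n : ℕ => 2 ^ 22 * ∑ A with ddPairsIn A ≠ ∅,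
      (((n : ℝ) / 14) ^ A.card * (density n / 2) ^ (ddPairsIn A).card)⁻¹) atTop (𝓝 0) := by
    have hterm : ∀ A ∈ Finset.univ.filter fun A => ddPairsIn A ≠ ∅, Tendsto (fun n : ℕ =>
        (((n : ℝ) / 14) ^ A.card * (density n / 2) ^ (ddPairsIn A).card)⁻¹) atTop (𝓝 0) := by
      intro A hA
      refine (hatTop _ _ ?_).inv_tendsto_atTop
      have h1 := card_ddPairsIn_le A
      have h2 := Finset.card_pos.2 (Finset.nonempty_iff_ne_empty.2 (Finset.mem_filter.1 hA).2)
      omega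
    simpa using (tendsto_finsetSum _ hterm).const_mul ((2 : ℝ) ^ 22)
  refine squeeze_zero' (.of_forall fun n => freq_nonneg _) ?_ hlim
  filter_upwards [eventually_stepCount, eventually_ge_atTop 7,
    (hatTop 7 10 (by norm_num)).eventually_ge_atTop (2 ^ 11)] with n hn hn7 hμ
  have hn0 : 0 < n := by omega
  have hd := density_pos hn0
  have hL : (n : ℝ) / 14 ≤ ((n / 7 : ℕ) : ℝ) := by
    have : n ≤ 14 * (n / 7) := by omega
    have : (n : ℝ) ≤ 14 * ((n / 7 : ℕ) : ℝ) := by exact_mod_cast this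
    linarith
  have hn0' : (0 : ℝ) < n := by exact_mod_cast hn0
  refine (freq_not_containsCopies_le (L := n / 7) (by omega) (stepCount_le hn0)
    (by omega) (hμ.trans ?_)).trans ?_
  · have := hn.2
    gcongr
  · refine mul_le_mul_of_nonneg_left (Finset.sum_le_sum fun A _ => ?_) (by positivity)
    have := hn.2
    gcongr

end Asymptotics

/-! ### Hitting times -/

section Main

/-- Two properties have the same hitting time if they agree up to some step in which they hold. -/
lemma hittingTime_congr {n : ℕ} (π : EdgeOrdering n) {P Q : SimpleGraph (Fin n) → Prop} (N : ℕ)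
    (hPQ : ∀ i ≤ N, (P (graphProcess π i) ↔ Q (graphProcess π i)))
    (hN : Q (graphProcess π N)) : hittingTime π P = hittingTime π Q := by
  have key : ∀ P Q : SimpleGraph (Fin n) → Prop,
      (∀ i ≤ N, (P (graphProcess π i) ↔ Q (graphProcess π i))) → P (graphProcess π N) →
      hittingTime π P ≤ hittingTime π Q := by
    intro P Q hPQ hP
    refine le_iInf₂ fun i hi => ?_
    rcases le_total i N with h | h
    · exact iInf₂_le i ((hPQ i h).2 hi)
    · exact (iInf₂_le N hP).trans (by exact_mod_cast h)
  exact le_antisymm (key P Q hPQ ((hPQ N le_rfl).2 hN))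
    (key Q P (fun i hi => (hPQ i hi).symm) hN)

lemma processProb_eq_freq (n : ℕ) (A : Set (EdgeOrdering n)) :
    processProb n A = ENNReal.ofReal (freq fun π => π ∈ A) := by
  classical
  have hc : (0 : ℝ) < Fintype.card (EdgeOrdering n) := by exact_mod_cast Fintype.card_pos
  rw [processProb, PMF.toOuterMeasure_uniformOfFintype_apply, freq_eq,
    ENNReal.ofReal_div_of_pos hc, ENNReal.ofReal_natCast, ENNReal.ofReal_natCast]
  congr 2
  rw [Fintype.card_subtype]

theorem mainTheorem2 :
    ProcessWhp (fun n => {π : EdgeOrdering n |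
      hittingTime π (IsMakerWin triangleGraph .maker) =
          hittingTime π (ContainsCopies 1 doubleDiamond) ∧
        hittingTime π (IsMakerWin triangleGraph .breaker) =
          hittingTime π (ContainsCopies 2 doubleDiamond)}) := by
  unfold ProcessWhp
  simp_rw [processProb_eq_freq]
  rw [← ENNReal.ofReal_one]
  refine ENNReal.tendsto_ofReal ?_
  have hlim := (sparse_whp.add containsCopies_whp).const_sub 1
  rw [add_zero, sub_zero] at hlim
  refine tendsto_of_tendsto_of_tendsto_of_le_of_le hlim tendsto_const_nhds (fun n => ?_)
    fun n => ?_
  · set A : EdgeOrdering n → Prop := fun π =>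
      hittingTime π (IsMakerWin triangleGraph .maker) =
          hittingTime π (ContainsCopies 1 doubleDiamond) ∧
        hittingTime π (IsMakerWin triangleGraph .breaker) =
          hittingTime π (ContainsCopies 2 doubleDiamond) with hA
    have h1 := freq_add_freq_not A
    have h2 : freq (fun π => ¬ A π) ≤ freq (fun π : EdgeOrdering n =>
        ¬ Sparse (graphProcess π (stepCount n)) ∨
        ¬ ContainsCopies 2 doubleDiamond (graphProcess π (stepCount n))) := by
      refine freq_mono fun π hπ => ?_
      by_contra! hcon
      obtain ⟨hs, hcop⟩ := hcon
      have hsi : ∀ i ≤ stepCount n, Sparse (graphProcess π i) := fun i hi =>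
        hs.anti (graphProcess_mono π hi)
      refine hπ ⟨hittingTime_congr π (stepCount n)
          (fun i hi => isMakerWin_maker_iff (hsi i hi)) ?_,
        hittingTime_congr π (stepCount n) (fun i hi => isMakerWin_breaker_iff (hsi i hi)) hcop⟩
      exact le_trans one_le_two hcop
    have h3 := freq_or_le (fun π : EdgeOrdering n => ¬ Sparse (graphProcess π (stepCount n)))
      (fun π => ¬ ContainsCopies 2 doubleDiamond (graphProcess π (stepCount n)))
    change _ ≤ freq A
    linarith
  · have h1 := freq_add_freq_not fun π : EdgeOrdering n =>
      π ∈ {π : EdgeOrdering n | hittingTime π (IsMakerWin triangleGraph .maker) =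
          hittingTime π (ContainsCopies 1 doubleDiamond) ∧
        hittingTime π (IsMakerWin triangleGraph .breaker) =
          hittingTime π (ContainsCopies 2 doubleDiamond)}
    have h2 := freq_nonneg fun π : EdgeOrdering n =>
      ¬ π ∈ {π : EdgeOrdering n | hittingTime π (IsMakerWin triangleGraph .maker) =
          hittingTime π (ContainsCopies 1 doubleDiamond) ∧
        hittingTime π (IsMakerWin triangleGraph .breaker) =
          hittingTime π (ContainsCopies 2 doubleDiamond)}
    change freq _ ≤ 1
    linarith

end Main
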